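/- For a compact Hausdorff connected space $X$ let $K^0(X)$ be the Grothendieck group of the monoid of isomorphism classes of complex vector bundles over $X$ under Whitney sum; for a base point $x_0\in X$ let $\tilde K^0(X)=\ker\big(K^0(X)\to K^0(\{x_0\})\big)$, and let $K^1(X)=\ker\big(K^0(X\times S^1)\to K^0(X\times\{1\})\big)$. For an abelian group $G$, a map $\sigma: G\to G$ has finite order if some positive iterate of it is the identity, and likewise for self-maps of spaces. Given a finitely generated abelian group $G$ and a finite order automorphism $\sigma$ of $G$, say that the realization question in $K$-theory has a positive answer for $(G,\sigma)$ if there exist a pointed connected finite CW-complex $(W,w_0)$ (the base point $w_0$ being a vertex) with $K^1(W)\cong\{0\}$, a homeomorphism $\beta: W\to W$ of finite order with $\beta(w_0)=w_0$, and an isomorphism $\varphi:\tilde K^0(W)\to G$ such that $\varphi\circ\beta^*=\sigma\circ\varphi$. Theorem. Let $k\ge 1$, let $G_1,\ldots,G_k$ be finitely generated abelian groups, and let $\sigma_i: G_i\to G_i$, $i=1,\ldots,k$, be finite order automorphisms. If the realization question in $K$-theory has a positive answer for each $(G_i,\sigma_i)$, then $G_1\oplus\cdots\oplus G_k$ is finitely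 generated, $\sigma_1\oplus\cdots\oplus\sigma_k$ has finite order, and the realization question in $K$-theory has a positive answer for $(G_1\oplus\cdots\oplus G_k,\ \sigma_1\oplus\cdots\oplus\sigma_k)$. -/

import Mathlib

open Bundle Set
open scoped DirectSum

noncomputable section

namespace TopKTheory

/-! ## Complex vector bundles -/

/-- A (finite-rank, locally trivial) complex vector bundle over `X`, with model fibre `F` and fibres
`E x`.  The rank is the dimension of `F`; over a connected base, the only case used below, every
complex vector bundle has constant rank. -/
structure CVectBundle (X : Type) [TopologicalSpace X] : Type 1 where
  F : Type
  E : X → Type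
  [normedAddCommGroup : NormedAddCommGroup F]
  [normedSpace : NormedSpace ℂ F]
  [finiteDimensional : FiniteDimensional ℂ F]
  [addCommMonoid : ∀ x, AddCommMonoid (E x)]
  [module : ∀ x, Module ℂ (E x)]
  [topFibre : ∀ x, TopologicalSpace (E x)]
  [topTotal : TopologicalSpace (TotalSpace F E)]
  [fiberBundle : FiberBundle F E]
  [vectorBundle : VectorBundle ℂ F E]

namespace CVectBundle

attribute [instance] normedAddCommGroup normedSpace finiteDimensional addCommMonoid module topFibre
  topTotal fiberBundle vectorBundle

variable {X Y Z : Type} [TopologicalSpace X] [TopologicalSpace Y] [TopologicalSpace Z]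

/-- The total space of a complex vector bundle. -/
abbrev Total (V : CVectBundle X) : Type := TotalSpace V.F V.E

/-- The map of total spaces given by a family of linear isomorphisms of the fibres. -/
def totalMap {V W : CVectBundle X} (e : ∀ x, V.E x ≃ₗ[ℂ] W.E x) (v : V.Total) : W.Total :=
  ⟨v.1, e v.1 v.2⟩

/-- Two bundles over `X` are isomorphic if there is a homeomorphism of total spaces over the
identity of `X` which is linear on each fibre. -/
def IsIso (V W : CVectBundle X) : Prop :=
  ∃ e : ∀ x, V.E x ≃ₗ[ℂ] W.E x,
    Continuous (totalMap e) ∧ Continuous (totalMap fun x => (e x).symm)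

theorem IsIso.refl (V : CVectBundle X) : IsIso V V :=
  ⟨fun x => LinearEquiv.refl ℂ (V.E x), continuous_id, continuous_id⟩

theorem IsIso.symm {V W : CVectBundle X} : IsIso V W → IsIso W V := by
  rintro ⟨e, h, h'⟩
  exact ⟨fun x => (e x).symm, h', h⟩

theorem IsIso.trans {U V W : CVectBundle X} : IsIso U V → IsIso V W → IsIso U W := by
  rintro ⟨e, h, h'⟩ ⟨f, k, k'⟩
  exact ⟨fun x => (e x).trans (f x), k.comp h, h'.comp k'⟩

instance setoid (X : Type) [TopologicalSpace X] : Setoid (CVectBundle X) where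
  r := IsIso
  iseqv := ⟨IsIso.refl, IsIso.symm, IsIso.trans⟩

/-- The Whitney sum of two vector bundles. -/
def sum (V W : CVectBundle X) : CVectBundle X where
  F := V.F × W.F
  E := V.E ×ᵇ W.E

/-- The zero bundle. -/
def zero (X : Type) [TopologicalSpace X] : CVectBundle X where
  F := PUnit
  E := Bundle.Trivial X PUnit

/-- The pullback of a vector bundle along a continuous map. -/
def pullback (f : C(X, Y)) (V : CVectBundle Y) : CVectBundle X where
  F := V.F
  E := f *ᵖ V.E

theorem continuous_to_sum {T : Type} [TopologicalSpace T] (V W : CVectBundle X)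
    {g : T → (sum V W).Total}
    (h₁ : Continuous fun t => (⟨(g t).1, (g t).2.1⟩ : V.Total))
    (h₂ : Continuous fun t => (⟨(g t).1, (g t).2.2⟩ : W.Total)) : Continuous g :=
  (FiberBundle.Prod.isInducing_diag V.F V.E W.F W.E).continuous_iff.2 (h₁.prodMk h₂)

theorem continuous_sum_fst (V W : CVectBundle X) :
    Continuous fun v : (sum V W).Total => (⟨v.1, v.2.1⟩ : V.Total) :=
  (FiberBundle.Prod.isInducing_diag V.F V.E W.F W.E).continuous.fst

theorem continuous_sum_snd (V W : CVectBundle X) :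
    Continuous fun v : (sum V W).Total => (⟨v.1, v.2.2⟩ : W.Total) :=
  (FiberBundle.Prod.isInducing_diag V.F V.E W.F W.E).continuous.snd

theorem continuous_to_zero {T : Type} [TopologicalSpace T] {g : T → (zero X).Total}
    (h : Continuous fun t => (g t).1) : Continuous g :=
  (Bundle.Trivial.isInducing_toProd X PUnit).continuous_iff.2 (h.prodMk (continuous_of_const fun _ _ => rfl))

theorem continuous_proj (V : CVectBundle X) : Continuous fun v : V.Total => v.1 :=
  FiberBundle.continuous_proj V.F V.E

theorem continuous_to_pullback {T : Type} [TopologicalSpace T] (f : C(X, Y)) (V : CVectBundle Y)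
    {g : T → (pullback f V).Total} (h₁ : Continuous fun t => (g t).1)
    (h₂ : Continuous fun t => (⟨f (g t).1, (g t).2⟩ : V.Total)) : Continuous g :=
  (inducing_pullbackTotalSpaceEmbedding V.F V.E f).continuous_iff.2 (h₁.prodMk h₂)

theorem continuous_lift (f : C(X, Y)) (V : CVectBundle Y) :
    Continuous fun v : (pullback f V).Total => (⟨f v.1, v.2⟩ : V.Total) :=
  Pullback.continuous_lift V.F V.E f

theorem IsIso.sum {V V' W W' : CVectBundle X} :
    IsIso V V' → IsIso W W' → IsIso (sum V W) (sum V' W') := by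
  rintro ⟨e, h, h'⟩ ⟨f, k, k'⟩
  exact ⟨fun x => (e x).prodCongr (f x),
    continuous_to_sum V' W' (h.comp (continuous_sum_fst V W)) (k.comp (continuous_sum_snd V W)),
    continuous_to_sum V W (h'.comp (continuous_sum_fst V' W'))
      (k'.comp (continuous_sum_snd V' W'))⟩

theorem sum_comm (V W : CVectBundle X) : IsIso (sum V W) (sum W V) :=
  ⟨fun x => LinearEquiv.prodComm ℂ (V.E x) (W.E x),
    continuous_to_sum W V (continuous_sum_snd V W) (continuous_sum_fst V W),
    continuous_to_sum V W (continuous_sum_snd W V) (continuous_sum_fst W V)⟩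

theorem sum_assoc (U V W : CVectBundle X) : IsIso (sum (sum U V) W) (sum U (sum V W)) :=
  ⟨fun x => LinearEquiv.prodAssoc ℂ (U.E x) (V.E x) (W.E x),
    continuous_to_sum U (sum V W)
      ((continuous_sum_fst U V).comp (continuous_sum_fst (sum U V) W))
      (continuous_to_sum V W ((continuous_sum_snd U V).comp (continuous_sum_fst (sum U V) W))
        (continuous_sum_snd (sum U V) W)),
    continuous_to_sum (sum U V) W
      (continuous_to_sum U V (continuous_sum_fst U (sum V W))
        ((continuous_sum_fst V W).comp (continuous_sum_snd U (sum V W))))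
      ((continuous_sum_snd V W).comp (continuous_sum_snd U (sum V W)))⟩

theorem zero_sum (V : CVectBundle X) : IsIso (sum (zero X) V) V :=
  ⟨fun x => (LinearEquiv.uniqueProd : (PUnit × V.E x) ≃ₗ[ℂ] V.E x),
    continuous_sum_snd (zero X) V,
    continuous_to_sum (zero X) V (continuous_to_zero (continuous_proj V)) continuous_id⟩

theorem IsIso.pullback (f : C(X, Y)) {V W : CVectBundle Y} :
    IsIso V W → IsIso (pullback f V) (pullback f W) := by
  rintro ⟨e, h, h'⟩
  exact ⟨fun x => e (f x),
    continuous_to_pullback f W (continuous_proj (CVectBundle.pullback f V))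
      (h.comp (continuous_lift f V)),
    continuous_to_pullback f V (continuous_proj (CVectBundle.pullback f W))
      (h'.comp (continuous_lift f W))⟩

theorem pullback_sum (f : C(X, Y)) (V W : CVectBundle Y) :
    IsIso (pullback f (sum V W)) (sum (pullback f V) (pullback f W)) :=
  ⟨fun x => LinearEquiv.refl ℂ (V.E (f x) × W.E (f x)),
    continuous_to_sum _ _
      (continuous_to_pullback f V (continuous_proj (pullback f (sum V W)))
        ((continuous_sum_fst V W).comp (continuous_lift f (sum V W))))
      (continuous_to_pullback f W (continuous_proj (pullback f (sum V W)))
        ((continuous_sum_snd V W).comp (continuous_lift f (sum V W)))),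
    continuous_to_pullback f (sum V W) (continuous_proj (sum (pullback f V) (pullback f W)))
      (continuous_to_sum V W
        ((continuous_lift f V).comp (continuous_sum_fst (pullback f V) (pullback f W)))
        ((continuous_lift f W).comp (continuous_sum_snd (pullback f V) (pullback f W))))⟩

theorem pullback_zero (f : C(X, Y)) : IsIso (pullback f (zero Y)) (zero X) :=
  ⟨fun _ => LinearEquiv.refl ℂ PUnit,
    continuous_to_zero (continuous_proj (pullback f (zero Y))),
    continuous_to_pullback f (zero Y) (continuous_proj (zero X))
      (continuous_to_zero (f.continuous.comp (continuous_proj (zero X))))⟩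

theorem pullback_comp (g : C(Y, Z)) (f : C(X, Y)) (V : CVectBundle Z) :
    IsIso (pullback (g.comp f) V) (pullback f (pullback g V)) :=
  ⟨fun x => LinearEquiv.refl ℂ (V.E (g (f x))),
    continuous_to_pullback f (pullback g V) (continuous_proj (pullback (g.comp f) V))
      (continuous_to_pullback g V (f.continuous.comp (continuous_proj (pullback (g.comp f) V)))
        (continuous_lift (g.comp f) V)),
    continuous_to_pullback (g.comp f) V (continuous_proj (pullback f (pullback g V)))
      ((continuous_lift g V).comp (continuous_lift f (pullback g V)))⟩

end CVectBundle

open CVectBundle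

variable {X Y Z : Type} [TopologicalSpace X] [TopologicalSpace Y] [TopologicalSpace Z]

/-! ## The group `K⁰` -/

/-- Isomorphism classes of complex vector bundles over `X`. -/
def Vect (X : Type) [TopologicalSpace X] : Type 1 := Quotient (CVectBundle.setoid X)

instance (X : Type) [TopologicalSpace X] : Add (Vect X) where
  add := Quotient.map₂ CVectBundle.sum fun _ _ h _ _ k => IsIso.sum h k

instance (X : Type) [TopologicalSpace X] : Zero (Vect X) where
  zero := Quotient.mk _ (CVectBundle.zero X)

/-- `Vect X` is a commutative monoid under Whitney sum. -/
instance (X : Type) [TopologicalSpace X] : AddCommMonoid (Vect X) where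
  add_assoc := by
    rintro ⟨U⟩ ⟨V⟩ ⟨W⟩
    exact Quotient.sound (sum_assoc U V W)
  add_comm := by
    rintro ⟨V⟩ ⟨W⟩
    exact Quotient.sound (sum_comm V W)
  zero_add := by
    rintro ⟨V⟩
    exact Quotient.sound (zero_sum V)
  add_zero := by
    rintro ⟨V⟩
    exact Quotient.sound ((sum_comm V _).trans (zero_sum V))
  nsmul := nsmulRec

/-- Pullback of isomorphism classes of vector bundles. -/
def Vect.pullback (f : C(X, Y)) : Vect Y →+ Vect X where
  toFun := Quotient.map (CVectBundle.pullback f) fun _ _ h => IsIso.pullback f h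
  map_zero' := Quotient.sound (pullback_zero f)
  map_add' := by
    rintro ⟨V⟩ ⟨W⟩
    exact Quotient.sound (pullback_sum f V W)

/-- `K⁰(X)`: the Grothendieck group of the monoid of isomorphism classes of complex vector
bundles over the (compact Hausdorff, connected) space `X`. -/
abbrev K0 (X : Type) [TopologicalSpace X] : Type 1 := Algebra.GrothendieckAddGroup (Vect X)

/-- The map `f^* : K⁰(Y) → K⁰(X)` induced by a continuous map `f : X → Y`. -/
def K0.map (f : C(X, Y)) : K0 Y →+ K0 X :=
  Algebra.GrothendieckAddGroup.lift (Algebra.GrothendieckAddGroup.of.comp (Vect.pullback f))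

theorem K0.map_of (f : C(X, Y)) (v : Vect Y) :
    K0.map f (Algebra.GrothendieckAddGroup.of v) =
      Algebra.GrothendieckAddGroup.of (Vect.pullback f v) :=
  DFunLike.congr_fun (Algebra.GrothendieckAddGroup.lift.symm_apply_apply
    (Algebra.GrothendieckAddGroup.of.comp (Vect.pullback f))) v

theorem K0.map_comp (g : C(Y, Z)) (f : C(X, Y)) :
    K0.map (g.comp f) = (K0.map f).comp (K0.map g) := by
  apply Algebra.GrothendieckAddGroup.lift.symm.injective
  ext v
  change K0.map (g.comp f) (Algebra.GrothendieckAddGroup.of v) =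
    K0.map f (K0.map g (Algebra.GrothendieckAddGroup.of v))
  rw [K0.map_of, K0.map_of, K0.map_of]
  congr 1
  induction v using Quotient.inductionOn with
  | h V => exact Quotient.sound (pullback_comp g f V)

/-- The reduced group `K̃⁰(X, x₀)`: the kernel of the restriction `K⁰(X) → K⁰(x₀)` to the base
point. -/
def reducedK0 (X : Type) [TopologicalSpace X] (x₀ : X) : AddSubgroup (K0 X) :=
  (K0.map (ContinuousMap.const PUnit x₀)).ker

/-- The map `f^* : K̃⁰(Y, y₀) → K̃⁰(X, x₀)` induced by a base point preserving continuous map `f`. -/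
def reducedK0.map {x₀ : X} {y₀ : Y} (f : C(X, Y)) (hf : f x₀ = y₀) :
    reducedK0 Y y₀ →+ reducedK0 X x₀ :=
  ((K0.map f).comp (reducedK0 Y y₀).subtype).codRestrict (reducedK0 X x₀) fun a => by
    have h : f.comp (ContinuousMap.const PUnit x₀) = ContinuousMap.const PUnit y₀ := by
      ext; exact hf
    change (K0.map (ContinuousMap.const PUnit x₀)).comp (K0.map f) (a : K0 Y) = 0
    rw [← K0.map_comp, h]
    exact a.2

/-- `K¹(X) = K⁻¹(X)`: the kernel of the restriction `K⁰(X × S¹) → K⁰(X × {1}) = K⁰(X)`. -/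
def K1 (X : Type) [TopologicalSpace X] : AddSubgroup (K0 (X × Circle)) :=
  (K0.map ((ContinuousMap.id X).prodMk (ContinuousMap.const X (1 : Circle)))).ker

/-! ## The realization question -/

/-- A self-map has finite order if some positive iterate of it is the identity. -/
def HasFiniteOrder {A : Type*} (f : A → A) : Prop := ∃ n : ℕ, 0 < n ∧ f^[n] = id

/-- A solution to the realization question in `K`-theory for an abelian group `G` with an
automorphism `σ`: a connected finite CW complex `W`, pointed at one of its vertices, with
`K̃⁰(W) ≅ G` and `K¹(W) ≅ 0`, and a base point preserving homeomorphism `β` of `W` of finite order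
such that, under the isomorphism `K̃⁰(W) ≅ G`, the induced map `β^*` is `σ`. -/
structure KRealization (G : Type*) [AddCommGroup G] (σ : G ≃+ G) where
  W : Type
  [top : TopologicalSpace W]
  [t2 : T2Space W]
  [connected : ConnectedSpace W]
  [cw : Topology.CWComplex (univ : Set W)]
  [finite : Topology.RelCWComplex.Finite (univ : Set W)]
  base : W
  base_vertex : ∃ v : Topology.RelCWComplex.cell (univ : Set W) 0,
    base ∈ Topology.RelCWComplex.closedCell (C := (univ : Set W)) 0 v
  β : W ≃ₜ W
  β_base : β base = base
  β_finite : HasFiniteOrder β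
  iso : reducedK0 W base ≃+ G
  iso_equivariant : ∀ a, iso (reducedK0.map (β : C(W, W)) β_base a) = σ (iso a)
  K1_trivial : Subsingleton (K1 W)

/-- The realization question in `K`-theory has a positive answer for `(G, σ)`. -/
def RealizationPositive (G : Type*) [AddCommGroup G] (σ : G ≃+ G) : Prop :=
  Nonempty (KRealization G σ)

/-- The direct sum `σ₁ ⊕ ⋯ ⊕ σ_k` of automorphisms. -/
def directSumAut {k : ℕ} {G : Fin k → Type*} [∀ i, AddCommGroup (G i)] (σ : ∀ i, G i ≃+ G i) :
    (⨁ i, G i) ≃+ ⨁ i, G i :=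
  DFinsupp.mapRange.addEquiv σ

end TopKTheory

end

noncomputable section

namespace TopKTheory

namespace CVectBundle

variable {X Y Z : Type} [TopologicalSpace X] [TopologicalSpace Y] [TopologicalSpace Z]

/-! ## Continuity of operations on total spaces -/

/-! The realizations are wedged together at their base vertices, with the wedge of the
homeomorphisms, and induction on `k` reduces everything to two summands. Inside the product, the
wedge is a closed set whose retractions onto the summands are the coordinate projections. It
inherits a finite CW structure, and its self-homeomorphism has order dividing the product of the two
orders.

The substance is that `K̃⁰` of the wedge is the product of the two reduced groups and that `K¹`
stays zero. Surjectivity onto the product comes from the retractions. Injectivity is a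
Mayer–Vietoris statement, `exists_isIso_sum_of_isClosed_cover`. Let `V` and `W` be isomorphic by `i`
over a closed set `A` and by `j` over a closed set `B`, where `A` and `B` cover `X`, and let `q`
retract `X` onto `A ∩ B`. The discrepancy `j⁻¹ i` lives over `A ∩ B`, but pulled back by `q` it
becomes an automorphism `g` of `U = q^* V` over all of `X`. Over `A ∩ B` the bundles `V` and `U`
coincide. This identification extends to homomorphisms `φ`, `ψ` over `X`, in general not invertible,
by a partition of unity. Whitehead's trick writes the rotation of `V ⊕ U` as a product of shears in
`φ` and `ψ`, so it is an automorphism everywhere. Conjugating `id ⊕ g` by it gives an automorphism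
of `V ⊕ U` equal to `j⁻¹ i ⊕ id` over `A ∩ B`. It corrects `j ⊕ id` so that it glues with `i ⊕ id`,
whence `V ⊕ U ≅ W ⊕ U` and the classes agree in `K⁰`.

No homotopy invariance enters, only retractions. The same criterion therefore applies to the wedge
times a circle, which gives `K¹`. -/

theorem continuousAt_total_iff {S : Type} [TopologicalSpace S] (V : CVectBundle X)
    {f : S → V.Total} {s : S} :
    ContinuousAt f s ↔ ContinuousAt (fun s => (f s).1) s ∧
      ContinuousAt (fun t => (trivializationAt V.F V.E (f s).1 (f t)).2) s :=
  FiberBundle.continuousAt_totalSpace V.F f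

theorem continuousAt_add {S : Type} [TopologicalSpace S] (V : CVectBundle X) {x : S → X}
    {f g : ∀ s, V.E (x s)} {s : S} (hf : ContinuousAt (fun s => (⟨x s, f s⟩ : V.Total)) s)
    (hg : ContinuousAt (fun s => (⟨x s, g s⟩ : V.Total)) s) :
    ContinuousAt (fun s => (⟨x s, f s + g s⟩ : V.Total)) s := by
  rw [continuousAt_total_iff] at hf hg ⊢
  refine ⟨hf.1, (hf.2.add hg.2).congr ?_⟩
  have hx : ContinuousAt x s := hf.1
  have := hx.preimage_mem_nhds
    ((trivializationAt V.F V.E (x s)).open_baseSet.mem_nhds (mem_baseSet_trivializationAt _ _ _))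
  filter_upwards [this] with t ht
  exact (((trivializationAt V.F V.E (x s)).linear ℂ ht).map_add _ _).symm

theorem continuousAt_smul {S : Type} [TopologicalSpace S] (V : CVectBundle X) {x : S → X}
    {c : S → ℂ} {f : ∀ s, V.E (x s)} {s : S} (hc : ContinuousAt c s)
    (hf : ContinuousAt (fun s => (⟨x s, f s⟩ : V.Total)) s) :
    ContinuousAt (fun s => (⟨x s, c s • f s⟩ : V.Total)) s := by
  rw [continuousAt_total_iff] at hf ⊢
  refine ⟨hf.1, (hc.smul hf.2).congr ?_⟩
  have hx : ContinuousAt x s := hf.1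
  have := hx.preimage_mem_nhds
    ((trivializationAt V.F V.E (x s)).open_baseSet.mem_nhds (mem_baseSet_trivializationAt _ _ _))
  filter_upwards [this] with t ht
  exact (((trivializationAt V.F V.E (x s)).linear ℂ ht).map_smul _ _).symm

theorem continuousAt_zero {S : Type} [TopologicalSpace S] (V : CVectBundle X) {x : S → X}
    {s : S} (hx : ContinuousAt x s) : ContinuousAt (fun s => (⟨x s, 0⟩ : V.Total)) s := by
  rw [continuousAt_total_iff]
  refine ⟨hx, (continuousAt_const (y := (0 : V.F))).congr ?_⟩
  have := hx.preimage_mem_nhds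
    ((trivializationAt V.F V.E (x s)).open_baseSet.mem_nhds (mem_baseSet_trivializationAt _ _ _))
  filter_upwards [this] with t ht
  exact (((trivializationAt V.F V.E (x s)).linear ℂ ht).map_zero).symm

/-! ## Bundle homomorphisms -/

/-- A homomorphism of vector bundles over the identity of the base. -/
structure Hom (V W : CVectBundle X) where
  f : ∀ x, V.E x →ₗ[ℂ] W.E x
  cont : Continuous fun v : V.Total => (⟨v.1, f v.1 v.2⟩ : W.Total)

namespace Hom

variable {V W : CVectBundle X}

/-- The zero homomorphism. -/
def zero (V W : CVectBundle X) : Hom V W where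
  f _ := 0
  cont := continuous_iff_continuousAt.2 fun _ =>
    W.continuousAt_zero (continuous_proj V).continuousAt

/-- The pointwise sum of two homomorphisms. -/
def add (φ ψ : Hom V W) : Hom V W where
  f x := φ.f x + ψ.f x
  cont := continuous_iff_continuousAt.2 fun _ =>
    W.continuousAt_add φ.cont.continuousAt ψ.cont.continuousAt

/-- The pointwise sum of finitely many homomorphisms. -/
theorem exists_sum {ι : Type} (s : Finset ι) (φ : ι → Hom V W) :
    ∃ ψ : Hom V W, ∀ x v, ψ.f x v = ∑ i ∈ s, (φ i).f x v := by
  classical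
  induction s using Finset.induction_on with
  | empty => exact ⟨zero V W, fun x v => by simp [zero]⟩
  | insert i s hi ih =>
    obtain ⟨ψ, hψ⟩ := ih
    exact ⟨(φ i).add ψ, fun x v => by rw [Finset.sum_insert hi, ← hψ]; rfl⟩

/-- The opposite of a homomorphism. -/
def neg (φ : Hom V W) : Hom V W where
  -- The fibres are only `AddCommMonoid`s, so additive inverses have to come from the scalar `-1`.
  f x := (-1 : ℂ) • φ.f x
  cont := continuous_iff_continuousAt.2 fun _ =>
    W.continuousAt_smul continuousAt_const φ.cont.continuousAt

/-- A homomorphism defined over an open set, cut off by a function supported in that set. -/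
def cutoff (φ : ∀ x, V.E x →ₗ[ℂ] W.E x) {N : Set X} (hN : IsOpen N)
    (hφ : ContinuousOn (fun v : V.Total => (⟨v.1, φ v.1 v.2⟩ : W.Total)) (TotalSpace.proj ⁻¹' N))
    (ρ : C(X, ℝ)) (hρ : tsupport ρ ⊆ N) : Hom V W where
  f x := (ρ x : ℂ) • φ x
  cont := continuous_iff_continuousAt.2 fun v => by
    have hp : ContinuousAt (fun v : V.Total => v.1) v := (continuous_proj V).continuousAt
    -- On the support, `φ` is continuous on a neighbourhood; off it, the product is locally zero.
    by_cases hv : v.1 ∈ tsupport ρ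
    · exact W.continuousAt_smul
        (f := fun v : V.Total => φ v.1 v.2)
        ((Complex.continuous_ofReal.comp ρ.continuous).continuousAt.comp hp)
        (hφ.continuousAt ((hN.preimage (continuous_proj V)).mem_nhds (hρ hv)))
    · refine (W.continuousAt_zero hp).congr ?_
      filter_upwards [hp.preimage_mem_nhds ((isClosed_tsupport ρ).isOpen_compl.mem_nhds hv)]
        with w hw
      have : ρ w.1 = 0 := image_eq_zero_of_notMem_tsupport hw
      simp [this]

end Hom

/-- Transport of vectors along an equality of base points. -/
def transport (V : CVectBundle X) {x y : X} (h : x = y) : V.E x ≃ₗ[ℂ] V.E y :=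
  h ▸ LinearEquiv.refl ℂ (V.E x)

/-- The linear map between two fibres given by a local trivialization. -/
def trivTransport (V : CVectBundle X) (c x y : X) : V.E x →ₗ[ℂ] V.E y :=
  ((trivializationAt V.F V.E c).symmₗ ℂ y).comp ((trivializationAt V.F V.E c).linearMapAt ℂ x)

theorem trivTransport_apply (V : CVectBundle X) {c x y : X}
    (hx : x ∈ (trivializationAt V.F V.E c).baseSet)
    (hy : y ∈ (trivializationAt V.F V.E c).baseSet) (v : V.E x) :
    V.trivTransport c x y v =
      (trivializationAt V.F V.E c).symm y (trivializationAt V.F V.E c ⟨x, v⟩).2 := by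
  rw [trivTransport, LinearMap.comp_apply, Trivialization.coe_symmₗ _ hy,
    Trivialization.coe_linearMapAt_of_mem _ hx]

/-- Over equal base points the result does not depend on the trivialization, so averaging over
several trivializations does not change it. -/
theorem trivTransport_eq (V : CVectBundle X) {c x y : X}
    (hx : x ∈ (trivializationAt V.F V.E c).baseSet) (h : x = y) (v : V.E x) :
    V.trivTransport c x y v = V.transport h v := by
  subst h
  exact (trivializationAt V.F V.E c).symmₗ_linearMapAt hx v

/-- In the trivialization around `c` the map is the identity of the model fibre. It makes sense
wherever `p` and `q` both land in the base set, even if they differ; this is what allows an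
extension beyond the set where they agree. -/
theorem continuousOn_trivTransport (V : CVectBundle X) (c : X) (p q : C(Y, X)) :
    ContinuousOn (fun v : (pullback p V).Total =>
        (⟨v.1, V.trivTransport c (p v.1) (q v.1) v.2⟩ : (pullback q V).Total))
      (TotalSpace.proj ⁻¹' (p ⁻¹' (trivializationAt V.F V.E c).baseSet ∩
        q ⁻¹' (trivializationAt V.F V.E c).baseSet)) := by
  set e := trivializationAt V.F V.E c
  rw [continuousOn_iff_continuous_domRestrict]
  refine continuous_to_pullback q V ((continuous_proj (pullback p V)).comp continuous_subtype_val) ?_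
  have h1 : Continuous fun v : (TotalSpace.proj ⁻¹' (p ⁻¹' e.baseSet ∩ q ⁻¹' e.baseSet) :
      Set (pullback p V).Total) => (e ⟨p v.1.1, v.1.2⟩).2 :=
    continuous_snd.comp (e.continuousOn.comp_continuous
      ((continuous_lift p V).comp continuous_subtype_val) fun v => e.mem_source.2 v.2.1)
  have h2 := e.continuousOn_symm.comp_continuous
    ((q.continuous.comp ((continuous_proj (pullback p V)).comp continuous_subtype_val)).prodMk h1)
    fun v => ⟨v.2.2, mem_univ _⟩
  refine h2.congr fun v => ?_
  exact (congrArg (TotalSpace.mk (q v.1.1)) (V.trivTransport_apply v.2.1 v.2.2 _)).symm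

/-- If two maps `p, q` agree on a closed set, the identity between the two pullbacks of a
bundle over that set extends to a homomorphism defined everywhere. -/
theorem exists_hom_extending_transport [CompactSpace Y] [T2Space Y] (V : CVectBundle X)
    (p q : C(Y, X)) {D : Set Y} (hD : IsClosed D) (hpq : ∀ y ∈ D, p y = q y) :
    ∃ φ : Hom (pullback p V) (pullback q V),
      ∀ y (hy : y ∈ D) (v : V.E (p y)), φ.f y v = V.transport (hpq y hy) v := by
  set N : Y → Set Y := fun y => p ⁻¹' (trivializationAt V.F V.E (p y)).baseSet ∩
    q ⁻¹' (trivializationAt V.F V.E (p y)).baseSet with hNdef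
  have hN : ∀ y, IsOpen (N y) := fun y =>
    ((trivializationAt V.F V.E (p y)).open_baseSet.preimage p.continuous).inter
      ((trivializationAt V.F V.E (p y)).open_baseSet.preimage q.continuous)
  have hDN : ∀ y ∈ D, y ∈ N y := fun y hy =>
    ⟨mem_baseSet_trivializationAt _ _ _, by
      rw [mem_preimage, ← hpq y hy]; exact mem_baseSet_trivializationAt _ _ _⟩
  obtain ⟨t, htD⟩ := hD.isCompact.elim_nhds_subcover' (fun y _ => N y)
    fun y hy => (hN y).mem_nhds (hDN y hy)
  obtain ⟨ρ, hρ⟩ := PartitionOfUnity.exists_isSubordinate hD (fun i : t => N i.1.1)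
    (fun i => hN _) (by simpa [subset_def] using htD)
  obtain ⟨φ, hφ⟩ := Hom.exists_sum (V := pullback p V) (W := pullback q V)
    Finset.univ fun i : t => Hom.cutoff (V := pullback p V) (W := pullback q V)
       (fun y => V.trivTransport (p i.1.1) (p y) (q y)) (hN i.1.1)
      (V.continuousOn_trivTransport (p i.1.1) p q) (ρ i) (hρ i)
  refine ⟨φ, fun y hy v => ?_⟩
  -- On `D` every local map with nonzero weight is the transport, and the weights add up to one
  -- there.
  have h1 : ∀ i : t, ((ρ i y : ℝ) : ℂ) • V.trivTransport (p i.1.1) (p y) (q y) v =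
      ((ρ i y : ℝ) : ℂ) • V.transport (hpq y hy) v := by
    intro i
    by_cases h : y ∈ N i.1.1
    · rw [V.trivTransport_eq h.1 (hpq y hy)]
    · have : ρ i y = 0 := image_eq_zero_of_notMem_tsupport fun h' => h (hρ i h')
      simp [this]
  refine (hφ y v).trans ((Finset.sum_congr rfl fun i _ => h1 i).trans ?_)
  rw [← Finset.sum_smul, ← Complex.ofReal_sum, ← finsum_eq_sum_of_fintype, ρ.sum_eq_one hy]
  simp
end CVectBundle

namespace CVectBundle

variable {X Y Z : Type} [TopologicalSpace X] [TopologicalSpace Y] [TopologicalSpace Z]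

/-! ## Isomorphisms of bundles as data -/

/-- An isomorphism of vector bundles over the identity of the base. -/
structure Iso (V W : CVectBundle X) where
  e : ∀ x, V.E x ≃ₗ[ℂ] W.E x
  cont : Continuous (totalMap e)
  cont_symm : Continuous (totalMap fun x => (e x).symm)

theorem isIso_iff_nonempty {V W : CVectBundle X} : IsIso V W ↔ Nonempty (Iso V W) :=
  ⟨fun ⟨e, h, h'⟩ => ⟨⟨e, h, h'⟩⟩, fun ⟨i⟩ => ⟨i.e, i.cont, i.cont_symm⟩⟩

namespace Iso

/-- The identity isomorphism. -/
def refl (V : CVectBundle X) : Iso V V :=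
  ⟨fun x => LinearEquiv.refl ℂ (V.E x), continuous_id, continuous_id⟩

/-- The inverse isomorphism. -/
def symm {V W : CVectBundle X} (i : Iso V W) : Iso W V :=
  ⟨fun x => (i.e x).symm, i.cont_symm, i.cont⟩

/-- The composition of two isomorphisms. -/
def trans {U V W : CVectBundle X} (i : Iso U V) (j : Iso V W) : Iso U W :=
  ⟨fun x => (i.e x).trans (j.e x), j.cont.comp i.cont, i.cont_symm.comp j.cont_symm⟩

/-- The Whitney sum of two isomorphisms. -/
def sum {V V' W W' : CVectBundle X} (i : Iso V V') (j : Iso W W') :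
    Iso (V.sum W) (V'.sum W') :=
  ⟨fun x => (i.e x).prodCongr (j.e x),
    continuous_to_sum V' W' (i.cont.comp (continuous_sum_fst V W))
      (j.cont.comp (continuous_sum_snd V W)),
    continuous_to_sum V W (i.cont_symm.comp (continuous_sum_fst V' W'))
      (j.cont_symm.comp (continuous_sum_snd V' W'))⟩

/-- The pullback of an isomorphism. -/
def pullback (f : C(X, Y)) {V W : CVectBundle Y} (i : Iso V W) :
    Iso (V.pullback f) (W.pullback f) :=
  ⟨fun x => i.e (f x),
    continuous_to_pullback f W (continuous_proj (V.pullback f))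
      (i.cont.comp (continuous_lift f V)),
    continuous_to_pullback f V (continuous_proj (W.pullback f))
      (i.cont_symm.comp (continuous_lift f W))⟩

/-- Pullback is compatible with Whitney sums. -/
def pullbackSum (f : C(X, Y)) (V W : CVectBundle Y) :
    Iso ((V.sum W).pullback f) ((V.pullback f).sum (W.pullback f)) :=
  ⟨fun x => LinearEquiv.refl ℂ (V.E (f x) × W.E (f x)),
    continuous_to_sum _ _
      (continuous_to_pullback f V (continuous_proj ((V.sum W).pullback f))
        ((continuous_sum_fst V W).comp (continuous_lift f (V.sum W))))
      (continuous_to_pullback f W (continuous_proj ((V.sum W).pullback f))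
        ((continuous_sum_snd V W).comp (continuous_lift f (V.sum W)))),
    continuous_to_pullback f (V.sum W) (continuous_proj ((V.pullback f).sum (W.pullback f)))
      (continuous_to_sum V W
        ((continuous_lift f V).comp (continuous_sum_fst (V.pullback f) (W.pullback f)))
        ((continuous_lift f W).comp (continuous_sum_snd (V.pullback f) (W.pullback f))))⟩

/-- Pullback is compatible with composition. -/
def pullbackComp (g : C(Y, Z)) (f : C(X, Y)) (V : CVectBundle Z) :
    Iso (V.pullback (g.comp f)) ((V.pullback g).pullback f) :=
  ⟨fun x => LinearEquiv.refl ℂ (V.E (g (f x))),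
    continuous_to_pullback f (V.pullback g) (continuous_proj (V.pullback (g.comp f)))
      (continuous_to_pullback g V (f.continuous.comp (continuous_proj (V.pullback (g.comp f))))
        (continuous_lift (g.comp f) V)),
    continuous_to_pullback (g.comp f) V (continuous_proj ((V.pullback g).pullback f))
      ((continuous_lift g V).comp (continuous_lift f (V.pullback g)))⟩

/-- Pullback along the identity. -/
def pullbackId (V : CVectBundle X) : Iso (V.pullback (ContinuousMap.id X)) V :=
  ⟨fun x => LinearEquiv.refl ℂ (V.E x), continuous_lift (ContinuousMap.id X) V,
    continuous_to_pullback (ContinuousMap.id X) V (continuous_proj V) continuous_id⟩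

/-- The isomorphism `(u, v) ↦ (u, v + φ u)`. -/
def shear {V W : CVectBundle X} (φ : Hom V W) : Iso (V.sum W) (V.sum W) where
  e x :=
    { toFun := fun w => (w.1, w.2 + φ.f x w.1)
      invFun := fun w => (w.1, w.2 + φ.neg.f x w.1)
      map_add' := fun w w' => by
        refine Prod.ext rfl ?_
        change (w.2 + w'.2) + φ.f x (w.1 + w'.1) = (w.2 + φ.f x w.1) + (w'.2 + φ.f x w'.1)
        rw [map_add, add_add_add_comm]
      map_smul' := fun c w => by
        refine Prod.ext rfl ?_
        change c • w.2 + φ.f x (c • w.1) = c • (w.2 + φ.f x w.1)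
        rw [map_smul, smul_add]
      left_inv := fun w => by
        refine Prod.ext rfl ?_
        change w.2 + φ.f x w.1 + (-1 : ℂ) • φ.f x w.1 = w.2
        -- Without subtraction in the fibre, the cancellation is done on the scalars: `1 + (-1) =
        -- 0`.
        rw [add_assoc]
        nth_rewrite 1 [← one_smul ℂ (φ.f x w.1)]
        rw [← add_smul, add_neg_cancel, zero_smul, add_zero]
      right_inv := fun w => by
        refine Prod.ext rfl ?_
        change w.2 + (-1 : ℂ) • φ.f x w.1 + φ.f x w.1 = w.2
        rw [add_assoc]
        nth_rewrite 2 [← one_smul ℂ (φ.f x w.1)]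
        rw [← add_smul, neg_add_cancel, zero_smul, add_zero] }
  cont := continuous_to_sum V W (continuous_sum_fst V W) (continuous_iff_continuousAt.2 fun _ =>
    W.continuousAt_add (continuous_sum_snd V W).continuousAt
      (φ.cont.comp (continuous_sum_fst V W)).continuousAt)
  cont_symm := continuous_to_sum V W (continuous_sum_fst V W)
    (continuous_iff_continuousAt.2 fun _ =>
    W.continuousAt_add (continuous_sum_snd V W).continuousAt
      (φ.neg.cont.comp (continuous_sum_fst V W)).continuousAt)

/-- Whitney sum is commutative. -/
def sumComm (V W : CVectBundle X) : Iso (V.sum W) (W.sum V) :=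
  ⟨fun x => LinearEquiv.prodComm ℂ (V.E x) (W.E x),
    continuous_to_sum W V (continuous_sum_snd V W) (continuous_sum_fst V W),
    continuous_to_sum V W (continuous_sum_snd W V) (continuous_sum_fst W V)⟩

/-- The isomorphism `(u, v) ↦ (u + ψ v, v)`. -/
def shear' {V W : CVectBundle X} (ψ : Hom W V) : Iso (V.sum W) (V.sum W) :=
  ((sumComm V W).trans (shear ψ)).trans (sumComm W V)

/-- A rotation of `V ⊕ W`, which is `(u, v) ↦ (v, -u)` wherever `φ` and `ψ` are inverse to each
other. -/
def rotation {V W : CVectBundle X} (φ : Hom V W) (ψ : Hom W V) : Iso (V.sum W) (V.sum W) :=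
  -- Each shear is invertible for arbitrary `φ` and `ψ`, hence so is the composite, even where they
  -- are not mutually inverse.
  ((shear' ψ).trans (shear φ.neg)).trans (shear' ψ)

theorem rotation_apply {V W : CVectBundle X} (φ : Hom V W) (ψ : Hom W V) {x : X}
    (h : ∀ u, ψ.f x (φ.f x u) = u) (h' : ∀ v, φ.f x (ψ.f x v) = v) (u : V.E x) (v : W.E x) :
    (rotation φ ψ).e x (u, v) = (ψ.f x v, (-1 : ℂ) • φ.f x u) := by
  have h1 : v + (-1 : ℂ) • φ.f x (u + ψ.f x v) = (-1 : ℂ) • φ.f x u := by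
    rw [map_add, h', smul_add, add_left_comm]
    nth_rewrite 1 [← one_smul ℂ v]
    rw [← add_smul, add_neg_cancel, zero_smul, add_zero]
  have h2 : u + ψ.f x v + ψ.f x ((-1 : ℂ) • φ.f x u) = ψ.f x v := by
    rw [map_smul, h, add_right_comm]
    nth_rewrite 1 [← one_smul ℂ u]
    rw [← add_smul, add_neg_cancel, zero_smul, zero_add]
  change (u + ψ.f x v + ψ.f x (v + (-1 : ℂ) • φ.f x (u + ψ.f x v)),
    v + (-1 : ℂ) • φ.f x (u + ψ.f x v)) = _
  rw [h1, h2]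

/-- An automorphism of the second summand, moved to the first one by a rotation. -/
def conj {V W : CVectBundle X} (φ : Hom V W) (ψ : Hom W V) (g : Iso W W) :
    Iso (V.sum W) (V.sum W) :=
  ((rotation φ ψ).symm.trans ((refl V).sum g)).trans (rotation φ ψ)

theorem conj_apply {V W : CVectBundle X} (φ : Hom V W) (ψ : Hom W V) (g : Iso W W) {x : X}
    (h : ∀ u, ψ.f x (φ.f x u) = u) (h' : ∀ v, φ.f x (ψ.f x v) = v) (u : V.E x) (v : W.E x) :
    (conj φ ψ g).e x (u, v) = (ψ.f x (g.e x (φ.f x u)), v) := by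
  have h1 : ((rotation φ ψ).e x).symm (u, v) = ((-1 : ℂ) • ψ.f x v, φ.f x u) := by
    refine (LinearEquiv.symm_apply_eq _).2 ((rotation_apply φ ψ h h' _ _).trans ?_).symm
    rw [map_smul, h, h', smul_smul]
    simp only [mul_neg, mul_one, neg_neg, one_smul]
    rfl
  change (rotation φ ψ).e x (((refl V).sum g).e x (((rotation φ ψ).e x).symm (u, v))) = _
  rw [h1]
  refine (rotation_apply φ ψ h h' _ _).trans ?_
  refine Prod.ext rfl ?_
  change (-1 : ℂ) • φ.f x ((-1 : ℂ) • ψ.f x v) = v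
  rw [map_smul, h', smul_smul]
  simp

end Iso

/-! ## Gluing isomorphisms along a closed cover -/

/-- The inclusion of a subspace. -/
def incl (A : Set X) : C(A, X) := ⟨Subtype.val, continuous_subtype_val⟩

theorem continuousOn_total_of_restrict {V W : CVectBundle X} {A : Set X}
    (E : ∀ x, V.E x ≃ₗ[ℂ] W.E x)
    (e : ∀ x : A, (V.pullback (incl A)).E x ≃ₗ[ℂ] (W.pullback (incl A)).E x)
    (he : Continuous (totalMap e)) (h : ∀ x : A, ∀ v, E x.1 v = e x v) :
    ContinuousOn (totalMap E) (TotalSpace.proj ⁻¹' A) := by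
  rw [continuousOn_iff_continuous_domRestrict]
  have h1 : Continuous fun v : (TotalSpace.proj ⁻¹' A : Set V.Total) =>
      (⟨⟨v.1.1, v.2⟩, v.1.2⟩ : (V.pullback (incl A)).Total) :=
    continuous_to_pullback (incl A) V
      (((continuous_proj V).comp continuous_subtype_val).subtype_mk _) continuous_subtype_val
  refine ((continuous_lift (incl A) W).comp (he.comp h1)).congr fun v => ?_
  exact congrArg (TotalSpace.mk v.1.1) (h ⟨v.1.1, v.2⟩ v.1.2).symm

/-- The pasting lemma for the closed preimages of `A` and `B` in the total spaces, applied to the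
glued map and to its inverse. -/
theorem isIso_of_isClosed_cover {V W : CVectBundle X} {A B : Set X} (hA : IsClosed A)
    (hB : IsClosed B) (hAB : ∀ x, x ∈ A ∨ x ∈ B)
    (i : Iso (V.pullback (incl A)) (W.pullback (incl A)))
    (j : Iso (V.pullback (incl B)) (W.pullback (incl B)))
    (h : ∀ x (ha : x ∈ A) (hb : x ∈ B) (v : V.E x), i.e ⟨x, ha⟩ v = j.e ⟨x, hb⟩ v) :
    IsIso V W := by
  classical
  let E : ∀ x, V.E x ≃ₗ[ℂ] W.E x := fun x =>
    if ha : x ∈ A then i.e ⟨x, ha⟩ else j.e ⟨x, (hAB x).resolve_left ha⟩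
  have hEA : ∀ x : A, E x.1 = i.e x := fun x => dif_pos x.2
  have hEB : ∀ x : B, E x.1 = j.e x := fun x => by
    by_cases ha : x.1 ∈ A
    · exact (hEA ⟨x.1, ha⟩).trans (LinearEquiv.ext fun v => h x.1 ha x.2 v)
    · exact dif_neg ha
  have hc : ∀ U : CVectBundle X,
      (univ : Set U.Total) = TotalSpace.proj ⁻¹' A ∪ TotalSpace.proj ⁻¹' B := fun U =>
    by ext v; simpa using hAB v.1
  refine ⟨E, ?_, ?_⟩
  · rw [← continuousOn_univ, hc]
    exact (continuousOn_total_of_restrict E i.e i.cont fun x v => by rw [hEA]; rfl).union_of_isClosed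
      (continuousOn_total_of_restrict E j.e j.cont fun x v => by rw [hEB]; rfl)
      (hA.preimage (continuous_proj V)) (hB.preimage (continuous_proj V))
  · rw [← continuousOn_univ, hc]
    exact (continuousOn_total_of_restrict (fun x => (E x).symm) (fun x => (i.e x).symm)
      i.cont_symm fun x v => by rw [hEA]; rfl).union_of_isClosed
      (continuousOn_total_of_restrict (fun x => (E x).symm) (fun x => (j.e x).symm)
      j.cont_symm fun x v => by rw [hEB]; rfl)
      (hA.preimage (continuous_proj W)) (hB.preimage (continuous_proj W))

/-- An isomorphism between pullbacks along `f`, pulled back further along `p`. -/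
def Iso.along (f : C(Y, X)) {V W : CVectBundle X} (i : Iso (V.pullback f) (W.pullback f))
    (p : C(Z, Y)) : Iso (V.pullback (f.comp p)) (W.pullback (f.comp p)) :=
  ((pullbackComp f p V).trans (i.pullback p)).trans (pullbackComp f p W).symm

/-- Needed because the fibre of `q^* V` at `x` lies over `q x`. The second point is a free variable
so that the equality can be substituted. -/
theorem transport_conj {A B : Set X} {V W : CVectBundle X}
    (i : ∀ x : A, V.E x.1 ≃ₗ[ℂ] W.E x.1) (j : ∀ x : B, V.E x.1 ≃ₗ[ℂ] W.E x.1) {x y : X} (h : x = y)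
    (ha : x ∈ A) (hb : x ∈ B) (ha' : y ∈ A) (hb' : y ∈ B) (v : V.E x) :
    V.transport h.symm ((j ⟨y, hb'⟩).symm (i ⟨y, ha'⟩ (V.transport h v))) =
      (j ⟨x, hb⟩).symm (i ⟨x, ha⟩ v) := by
  subst h; rfl

/-- If two bundles become isomorphic over two closed sets covering the base and the base retracts
to their intersection, then the bundles are stably isomorphic. -/
theorem exists_isIso_sum_of_isClosed_cover [CompactSpace X] [T2Space X] {V W : CVectBundle X}
    {A B : Set X} (hA : IsClosed A) (hB : IsClosed B) (hAB : ∀ x, x ∈ A ∨ x ∈ B)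
    (q : C(X, X)) (hqA : ∀ x, q x ∈ A) (hqB : ∀ x, q x ∈ B)
    (hq : ∀ x, x ∈ A → x ∈ B → x = q x)
    (i : Iso (V.pullback (incl A)) (W.pullback (incl A)))
    (j : Iso (V.pullback (incl B)) (W.pullback (incl B))) :
    ∃ U, IsIso (V.sum U) (W.sum U) := by
  let U := V.pullback q
  let g₁ : Iso (V.pullback q) (W.pullback q) := i.along (incl A)
    ⟨fun x => ⟨q x, hqA x⟩, q.continuous.subtype_mk _⟩
  let g₂ : Iso (V.pullback q) (W.pullback q) := j.along (incl B)
    ⟨fun x => ⟨q x, hqB x⟩, q.continuous.subtype_mk _⟩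
  -- The discrepancy `j⁻¹ i` at `q x`, now defined for every `x`.
  let g : Iso U U := g₁.trans g₂.symm
  obtain ⟨φ, hφ⟩ := V.exists_hom_extending_transport (ContinuousMap.id X) q (hA.inter hB)
    fun x hx => hq x hx.1 hx.2
  obtain ⟨ψ, hψ⟩ := V.exists_hom_extending_transport q (ContinuousMap.id X) (hA.inter hB)
    fun x hx => (hq x hx.1 hx.2).symm
  let κ := ((Iso.pullbackId V).symm.sum (Iso.refl U)).trans
    ((Iso.conj φ ψ g).trans ((Iso.pullbackId V).sum (Iso.refl U)))
  let i' := ((Iso.pullbackSum (incl A) V U).trans (i.sum (Iso.refl _))).trans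
    (Iso.pullbackSum (incl A) W U).symm
  let j' := ((Iso.pullbackSum (incl B) V U).trans (j.sum (Iso.refl _))).trans
    (Iso.pullbackSum (incl B) W U).symm
  -- Over `B`, the automorphism `κ` is applied before `j ⊕ id`; on the overlap it equals `j⁻¹ i ⊕
  -- id`, so the result is `i ⊕ id`.
  refine ⟨U, isIso_of_isClosed_cover hA hB hAB i' ((κ.pullback (incl B)).trans j') ?_⟩
  rintro x ha hb ⟨u, v⟩
  have key : (Iso.conj φ ψ g).e x (u, v) = ((j.e ⟨x, hb⟩).symm (i.e ⟨x, ha⟩ u), v) := by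
    have hT : ∀ {y : X} (h : x = y) (h' : y = x) (w : V.E x),
        V.transport h' (V.transport h w) = w := by intro y h h' w; subst h; rfl
    have hT' : ∀ {y : X} (h : x = y) (h' : y = x) (w : V.E y),
        V.transport h (V.transport h' w) = w := by intro y h h' w; subst h; rfl
    refine (Iso.conj_apply φ ψ g (fun u => ?_) (fun v => ?_) u v).trans ?_
    · exact (congrArg _ (hφ x ⟨ha, hb⟩ u)).trans ((hψ x ⟨ha, hb⟩ _).trans (hT _ _ _))
    · exact (congrArg _ (hψ x ⟨ha, hb⟩ v)).trans ((hφ x ⟨ha, hb⟩ _).trans (hT' _ _ _))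
    · refine Prod.ext ?_ rfl
      refine (hψ x ⟨ha, hb⟩ _).trans ?_
      refine (congrArg (fun w => V.transport (hq x ha hb).symm (g.e x w))
        (hφ x ⟨ha, hb⟩ u)).trans ?_
      exact transport_conj i.e j.e (hq x ha hb) ha hb (hqA x) (hqB x) u
  have : j'.e ⟨x, hb⟩ ((Iso.conj φ ψ g).e x (u, v)) = i'.e ⟨x, ha⟩ (u, v) := by
    rw [key]
    exact Prod.ext ((j.e ⟨x, hb⟩).apply_symm_apply _) rfl
  exact this.symm

end CVectBundle

/-! ### Classes in `K⁰` and the Mayer–Vietoris vanishing criterion. -/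

open CVectBundle

variable {X Y Z : Type} [TopologicalSpace X] [TopologicalSpace Y] [TopologicalSpace Z]

/-- The isomorphism class of a vector bundle. -/
def Vect.mk (V : CVectBundle X) : Vect X := Quotient.mk _ V

theorem Vect.exists_eq_mk (v : Vect X) : ∃ V, v = Vect.mk V :=
  (Quotient.exists_rep v).imp fun _ h => h.symm

theorem Vect.mk_eq_mk_iff {V W : CVectBundle X} : Vect.mk V = Vect.mk W ↔ IsIso V W :=
  Quotient.eq

theorem K0.exists_eq_of_sub_of (z : K0 X) : ∃ v w : Vect X,
    z = Algebra.GrothendieckAddGroup.of v - Algebra.GrothendieckAddGroup.of w := by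
  obtain ⟨⟨v, w⟩, h⟩ := (AddLocalization.addMonoidOf (⊤ : AddSubmonoid (Vect X))).surj z
  exact ⟨v, w, eq_sub_of_add_eq h⟩

theorem K0.of_eq_of_iff {v w : Vect X} :
    (Algebra.GrothendieckAddGroup.of v : K0 X) = Algebra.GrothendieckAddGroup.of w ↔
      ∃ c : Vect X, c + v = c + w := by
  refine ((AddLocalization.addMonoidOf (⊤ : AddSubmonoid (Vect X))).eq_iff_exists).trans ?_
  exact ⟨fun ⟨c, hc⟩ => ⟨c, hc⟩, fun ⟨c, hc⟩ => ⟨⟨c, trivial⟩, hc⟩⟩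

theorem Vect.pullback_comp_apply (g : C(Y, Z)) (f : C(X, Y)) (v : Vect Z) :
    Vect.pullback (g.comp f) v = Vect.pullback f (Vect.pullback g v) := by
  obtain ⟨V, rfl⟩ := v.exists_eq_mk
  exact Vect.mk_eq_mk_iff.2 (pullback_comp g f V)

theorem K0.map_map (g : C(Y, Z)) (f : C(X, Y)) (z : K0 Z) :
    K0.map f (K0.map g z) = K0.map (g.comp f) z := by
  rw [K0.map_comp]; rfl

theorem K0.map_id (z : K0 X) : K0.map (ContinuousMap.id X) z = z := by
  obtain ⟨v, w, rfl⟩ := K0.exists_eq_of_sub_of z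
  have h : ∀ v : Vect X, Vect.pullback (ContinuousMap.id X) v = v := fun v => by
    obtain ⟨V, rfl⟩ := v.exists_eq_mk
    exact Vect.mk_eq_mk_iff.2 (isIso_iff_nonempty.2 ⟨Iso.pullbackId V⟩)
  rw [map_sub, K0.map_of, K0.map_of, h, h]

/-- If two bundles have isomorphic pullbacks along two maps `a` and `b` whose fixed point sets cover
the base, and the base retracts to the set of common fixed points, then they have the same class. -/
theorem K0.of_eq_of_pullback_eq [CompactSpace X] [T2Space X] (a b q : C(X, X))
    (hab : ∀ x, a x = x ∨ b x = x) (hqa : ∀ x, a (q x) = q x) (hqb : ∀ x, b (q x) = q x)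
    (hq : ∀ x, a x = x → b x = x → x = q x) {v w : Vect X}
    (hva : Vect.pullback a v = Vect.pullback a w) (hvb : Vect.pullback b v = Vect.pullback b w) :
    (Algebra.GrothendieckAddGroup.of v : K0 X) = Algebra.GrothendieckAddGroup.of w := by
  have key : ∀ (c : C(X, X)) (V W : CVectBundle X),
      Vect.pullback c (Vect.mk V) = Vect.pullback c (Vect.mk W) →
      Nonempty (Iso (V.pullback (incl {x | c x = x})) (W.pullback (incl {x | c x = x}))) := by
    intro c V W h
    -- On its fixed point set `c` is the inclusion, so `c^*` determines the restriction to that set.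
    have hc : c.comp (incl {x | c x = x}) = incl {x | c x = x} := by ext x; exact x.2
    have h' : Vect.pullback (incl {x | c x = x}) (Vect.mk V) =
        Vect.pullback (incl {x | c x = x}) (Vect.mk W) := by
      rw [← hc, Vect.pullback_comp_apply, h, Vect.pullback_comp_apply]
    exact isIso_iff_nonempty.1 (Vect.mk_eq_mk_iff.1 h')
  obtain ⟨V, rfl⟩ := v.exists_eq_mk
  obtain ⟨W, rfl⟩ := w.exists_eq_mk
  obtain ⟨i⟩ := key a V W hva
  obtain ⟨j⟩ := key b V W hvb
  obtain ⟨U, hU⟩ := exists_isIso_sum_of_isClosed_cover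
    (isClosed_eq a.continuous continuous_id) (isClosed_eq b.continuous continuous_id)
    hab q hqa hqb hq i j
  refine K0.of_eq_of_iff.2 ⟨Vect.mk U, ?_⟩
  rw [add_comm, add_comm _ (Vect.mk W)]
  exact Vect.mk_eq_mk_iff.2 hU

/-- Mayer–Vietoris vanishing: a class in `K⁰(X)` restricting to zero on two closed sets which cover
`X` vanishes if `X` retracts to their intersection by `q` and to them by `a` and `b`. -/
theorem K0.eq_zero_of_map_retraction_eq_zero [CompactSpace X] [T2Space X] (a b q : C(X, X))
    (ha : ∀ x, a (a x) = a x) (hb : ∀ x, b (b x) = b x) (hab : ∀ x, a x = x ∨ b x = x)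
    (hqa : ∀ x, a (q x) = q x) (hqb : ∀ x, b (q x) = q x)
    (hq : ∀ x, a x = x → b x = x → x = q x)
    {z : K0 X} (hza : K0.map a z = 0) (hzb : K0.map b z = 0) : z = 0 := by
  obtain ⟨v, w, rfl⟩ := K0.exists_eq_of_sub_of z
  have key : ∀ c : C(X, X), (∀ x, c (c x) = c x) →
      K0.map c (Algebra.GrothendieckAddGroup.of v - Algebra.GrothendieckAddGroup.of w) = 0 →
      ∃ u, Vect.pullback c (u + v) = Vect.pullback c (u + w) := by
    intro c hc h
    rw [map_sub, sub_eq_zero, K0.map_of, K0.map_of, K0.of_eq_of_iff] at h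
    obtain ⟨u, hu⟩ := h
    have hcc : c.comp c = c := ContinuousMap.ext hc
    -- Vanishing in `K⁰` gives only the stable equality `u + c^* v = u + c^* w`. Pulling back once
    -- more by the idempotent `c` replaces `u` by `c^* u`.
    have := congrArg (Vect.pullback c) hu
    simp only [map_add, ← Vect.pullback_comp_apply, hcc] at this
    exact ⟨u, by simpa only [map_add] using this⟩
  obtain ⟨u, hu⟩ := key a ha hza
  obtain ⟨u', hu'⟩ := key b hb hzb
  -- Adding both stabilizing summands produces one pair of classes that agrees under `a^*` and under
  -- `b^*`.
  have h := K0.of_eq_of_pullback_eq a b q hab hqa hqb hq (v := u' + (u + v)) (w := u' + (u + w))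
    (by rw [map_add, hu, ← map_add])
    (by rw [add_left_comm, map_add, hu', ← map_add, add_left_comm])
  simpa only [map_add, add_right_inj, ← sub_eq_zero (b := Algebra.GrothendieckAddGroup.of w)] using h

/-! ## The wedge of two pointed spaces -/

/-- The wedge of `(X, x₀)` and `(Y, y₀)`, realised as a subspace of the product. -/
abbrev Wedge {X Y : Type} (x₀ : X) (y₀ : Y) : Type := {p : X × Y // p.1 = x₀ ∨ p.2 = y₀}

namespace Wedge

variable {X Y : Type} [TopologicalSpace X] [TopologicalSpace Y] {x₀ : X} {y₀ : Y}

variable (x₀ y₀) in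
/-- The inclusion of the first summand. -/
def inl : C(X, Wedge x₀ y₀) :=
  ⟨fun x => ⟨(x, y₀), Or.inr rfl⟩, (continuous_id.prodMk continuous_const).subtype_mk _⟩

variable (x₀ y₀) in
/-- The inclusion of the second summand. -/
def inr : C(Y, Wedge x₀ y₀) :=
  ⟨fun y => ⟨(x₀, y), Or.inl rfl⟩, (continuous_const.prodMk continuous_id).subtype_mk _⟩

variable (x₀ y₀) in
/-- The retraction onto the first summand. -/
def fst : C(Wedge x₀ y₀, X) := ⟨fun p => p.1.1, continuous_fst.comp continuous_subtype_val⟩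

variable (x₀ y₀) in
/-- The retraction onto the second summand. -/
def snd : C(Wedge x₀ y₀, Y) := ⟨fun p => p.1.2, continuous_snd.comp continuous_subtype_val⟩

variable (x₀ y₀) in
/-- The base point of the wedge. -/
def base : Wedge x₀ y₀ := ⟨(x₀, y₀), Or.inl rfl⟩

@[simp] theorem fst_inl (x : X) : fst x₀ y₀ (inl x₀ y₀ x) = x := rfl

@[simp] theorem fst_inr (y : Y) : fst x₀ y₀ (inr x₀ y₀ y) = x₀ := rfl

@[simp] theorem snd_inl (x : X) : snd x₀ y₀ (inl x₀ y₀ x) = y₀ := rfl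

@[simp] theorem snd_inr (y : Y) : snd x₀ y₀ (inr x₀ y₀ y) = y := rfl

theorem inl_fst_or_inr_snd (p : Wedge x₀ y₀) :
    inl x₀ y₀ (fst x₀ y₀ p) = p ∨ inr x₀ y₀ (snd x₀ y₀ p) = p := by
  obtain ⟨⟨x, y⟩, rfl | rfl⟩ := p
  · exact Or.inr rfl
  · exact Or.inl rfl

theorem eq_base {p : Wedge x₀ y₀} (h : inl x₀ y₀ (fst x₀ y₀ p) = p)
    (h' : inr x₀ y₀ (snd x₀ y₀ p) = p) : p = base x₀ y₀ := by
  have h1 := congrArg (fst x₀ y₀) h'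
  have h2 := congrArg (snd x₀ y₀) h
  exact Subtype.ext (Prod.ext h1.symm h2.symm)

instance [T1Space X] [T1Space Y] [CompactSpace X] [CompactSpace Y] :
    CompactSpace (Wedge x₀ y₀) :=
  isCompact_iff_compactSpace.1 ((isClosed_singleton.preimage continuous_fst).union
    (isClosed_singleton.preimage continuous_snd)).isCompact

instance [ConnectedSpace X] [ConnectedSpace Y] : ConnectedSpace (Wedge x₀ y₀) := by
  rw [connectedSpace_iff_univ]
  have h : (univ : Set (Wedge x₀ y₀)) = range (inl x₀ y₀) ∪ range (inr x₀ y₀) := by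
    refine (eq_univ_of_forall fun p => ?_).symm
    exact (inl_fst_or_inr_snd p).imp (fun h => ⟨_, h⟩) fun h => ⟨_, h⟩
  rw [h]
  exact IsConnected.union ⟨base x₀ y₀, ⟨x₀, rfl⟩, ⟨y₀, rfl⟩⟩
    (isConnected_range (inl x₀ y₀).continuous) (isConnected_range (inr x₀ y₀).continuous)

end Wedge

/-! ## Finite CW complexes -/

section CW

open Topology Metric

/-- The composition of a characteristic map with the inclusion of a retract. -/
def pushMap {n : ℕ} {X W : Type} (f : X → W) (r : W → X) (h : ∀ x, r (f x) = x)
    (m : PartialEquiv (Fin n → ℝ) X) : PartialEquiv (Fin n → ℝ) W where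
  toFun := f ∘ m
  invFun := m.symm ∘ r
  source := m.source
  target := f '' m.target
  map_source' x hx := mem_image_of_mem f (m.map_source hx)
  map_target' := by
    rintro _ ⟨x, hx, rfl⟩
    simpa [h] using m.map_target hx
  left_inv' x hx := by simpa [h] using m.left_inv hx
  right_inv' := by
    rintro _ ⟨x, hx, rfl⟩
    simpa [h] using congrArg f (m.right_inv hx)

theorem continuousOn_symm_pushMap {n : ℕ} {X W : Type} [TopologicalSpace X] [TopologicalSpace W]
    (f : X → W) {r : W → X} (hr : Continuous r) (h : ∀ x, r (f x) = x)
    {m : PartialEquiv (Fin n → ℝ) X} (hm : ContinuousOn m.symm m.target) :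
    ContinuousOn (pushMap f r h m).symm (pushMap f r h m).target :=
  hm.comp hr.continuousOn (by rintro _ ⟨x, hx, rfl⟩; simpa [h] using hx)

theorem compactSpace_of_finite_cwComplex (X : Type) [TopologicalSpace X]
    [CWComplex (univ : Set X)] [RelCWComplex.Finite (univ : Set X)] : CompactSpace X := by
  have : Finite (Σ n, RelCWComplex.cell (univ : Set X) n) := RelCWComplex.finite_cells_of_finite
  refine ⟨?_⟩
  rw [← CWComplex.union (C := (univ : Set X)),
    iUnion_sigma' fun n j => RelCWComplex.closedCell (C := (univ : Set X)) n j]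
  exact isCompact_iUnion fun _ => RelCWComplex.isCompact_closedCell

/-- Open cells are disjoint, so the only one containing a vertex is that vertex. Hence `WedgeCell`
drops nothing from `Y` but a single point. -/
theorem eq_of_vertex_mem_openCell {Y : Type} [TopologicalSpace Y] [CWComplex (univ : Set Y)]
    {y₀ : Y} (hy : ∃ v : RelCWComplex.cell (univ : Set Y) 0,
      y₀ ∈ RelCWComplex.closedCell (C := (univ : Set Y)) 0 v) {n : ℕ}
    {j : RelCWComplex.cell (univ : Set Y) n} (h : y₀ ∈ RelCWComplex.openCell n j) {y : Y}
    (hyj : y ∈ RelCWComplex.closedCell n j) : y = y₀ := by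
  obtain ⟨v, hv⟩ := hy
  rw [RelCWComplex.closedCell_zero_eq_singleton] at hv
  have hv' : y₀ ∈ RelCWComplex.openCell 0 v := by
    rwa [RelCWComplex.openCell_zero_eq_singleton]
  have := RelCWComplex.eq_of_not_disjoint_openCell (not_disjoint_iff.2 ⟨y₀, h, hv'⟩)
  obtain ⟨rfl, h⟩ := Sigma.mk.inj_iff.1 this
  obtain rfl := eq_of_heq h
  rw [RelCWComplex.closedCell_zero_eq_singleton] at hyj
  exact hyj.trans hv.symm

variable {X Y : Type} [TopologicalSpace X] [TopologicalSpace Y] [CWComplex (univ : Set X)]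
  [CWComplex (univ : Set Y)] (x₀ : X) (y₀ : Y)

/-- The cells of the wedge: those of `X`, and those of `Y` other than the base point. -/
abbrev WedgeCell (n : ℕ) : Type := RelCWComplex.cell (univ : Set X) n ⊕
  {j : RelCWComplex.cell (univ : Set Y) n // y₀ ∉ RelCWComplex.openCell n j}

/-- The characteristic maps of the cells of the wedge. -/
def wedgeMap (n : ℕ) : WedgeCell (X := X) y₀ n → PartialEquiv (Fin n → ℝ) (Wedge x₀ y₀) :=
  Sum.elim
    (fun i => pushMap (Wedge.inl x₀ y₀) (Wedge.fst x₀ y₀) Wedge.fst_inl (RelCWComplex.map n i))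
    fun j => pushMap (Wedge.inr x₀ y₀) (Wedge.snd x₀ y₀) Wedge.snd_inr (RelCWComplex.map n j.1)

theorem wedgeMap_inl_image {n : ℕ} (i : RelCWComplex.cell (univ : Set X) n)
    (s : Set (Fin n → ℝ)) : wedgeMap x₀ y₀ n (Sum.inl i) '' s =
      Wedge.inl x₀ y₀ '' (RelCWComplex.map n i '' s) :=
  image_comp (Wedge.inl x₀ y₀) (RelCWComplex.map n i) s

theorem wedgeMap_inr_image {n : ℕ}
    (j : {j : RelCWComplex.cell (univ : Set Y) n // y₀ ∉ RelCWComplex.openCell n j})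
    (s : Set (Fin n → ℝ)) : wedgeMap x₀ y₀ n (Sum.inr j) '' s =
      Wedge.inr x₀ y₀ '' (RelCWComplex.map n j.1 '' s) :=
  image_comp (Wedge.inr x₀ y₀) (RelCWComplex.map n j.1) s

variable {x₀ y₀}

theorem inl_mem_wedgeMap {m n : ℕ} (hmn : m < n) {x : X} {i : RelCWComplex.cell (univ : Set X) m}
    (hx : x ∈ RelCWComplex.closedCell m i) :
    Wedge.inl x₀ y₀ x ∈ ⋃ (m < n) (j : WedgeCell y₀ m), wedgeMap x₀ y₀ m j '' closedBall 0 1 := by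
  refine mem_iUnion₂.2 ⟨m, hmn, mem_iUnion.2 ⟨Sum.inl i, ?_⟩⟩
  rw [wedgeMap_inl_image]
  exact mem_image_of_mem _ hx

theorem inr_mem_wedgeMap
    (hx : ∃ v : RelCWComplex.cell (univ : Set X) 0,
      x₀ ∈ RelCWComplex.closedCell (C := (univ : Set X)) 0 v)
    (hy : ∃ v : RelCWComplex.cell (univ : Set Y) 0,
      y₀ ∈ RelCWComplex.closedCell (C := (univ : Set Y)) 0 v) {m n : ℕ} (hmn : m < n) {y : Y}
    {j : RelCWComplex.cell (univ : Set Y) m} (hyj : y ∈ RelCWComplex.closedCell m j) :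
    Wedge.inr x₀ y₀ y ∈ ⋃ (m < n) (j : WedgeCell (X := X) y₀ m),
      wedgeMap x₀ y₀ m j '' closedBall 0 1 := by
  by_cases h : y₀ ∈ RelCWComplex.openCell m j
  · obtain rfl := eq_of_vertex_mem_openCell hy h hyj
    -- The dropped cell is the base point, which is also the vertex `x₀` of `X`, of dimension `0 ≤ m
    -- < n`.
    exact inl_mem_wedgeMap (hmn.trans_le' m.zero_le) hx.choose_spec
  · refine mem_iUnion₂.2 ⟨m, hmn, mem_iUnion.2 ⟨Sum.inr ⟨j, h⟩, ?_⟩⟩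
    rw [wedgeMap_inr_image]
    exact mem_image_of_mem _ hyj

theorem wedgeMap_source (n : ℕ) (i : WedgeCell (X := X) y₀ n) :
    (wedgeMap x₀ y₀ n i).source = ball 0 1 := by
  obtain i | j := i
  · exact RelCWComplex.source_eq n i
  · exact RelCWComplex.source_eq n j.1

theorem continuousOn_wedgeMap (n : ℕ) (i : WedgeCell (X := X) y₀ n) :
    ContinuousOn (wedgeMap x₀ y₀ n i) (closedBall 0 1) := by
  obtain i | j := i
  · exact (Wedge.inl x₀ y₀).continuous.comp_continuousOn (RelCWComplex.continuousOn n i)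
  · exact (Wedge.inr x₀ y₀).continuous.comp_continuousOn (RelCWComplex.continuousOn n j.1)

theorem continuousOn_wedgeMap_symm (n : ℕ) (i : WedgeCell (X := X) y₀ n) :
    ContinuousOn (wedgeMap x₀ y₀ n i).symm (wedgeMap x₀ y₀ n i).target := by
  obtain i | j := i
  · exact continuousOn_symm_pushMap _ (Wedge.fst x₀ y₀).continuous Wedge.fst_inl
      (RelCWComplex.continuousOn_symm n i)
  · exact continuousOn_symm_pushMap _ (Wedge.snd x₀ y₀).continuous Wedge.snd_inr
      (RelCWComplex.continuousOn_symm n j.1)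

theorem pairwiseDisjoint_wedgeMap : (univ : Set (Σ n, WedgeCell (X := X) y₀ n)).PairwiseDisjoint
    fun ni => wedgeMap x₀ y₀ ni.1 ni.2 '' ball 0 1 := by
  rintro ⟨n, i⟩ - ⟨m, j⟩ - hne
  by_contra hd
  obtain ⟨p, hp, hp'⟩ := not_disjoint_iff.1 hd
  apply hne
  obtain i | i := i <;> obtain j | j := j
  · replace hp := (wedgeMap_inl_image x₀ y₀ i _).subset hp
    replace hp' := (wedgeMap_inl_image x₀ y₀ j _).subset hp'
    obtain ⟨x, hx, rfl⟩ := hp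
    obtain ⟨x', hx', h⟩ := hp'
    obtain rfl : x' = x := congrArg (Wedge.fst x₀ y₀) h
    obtain ⟨rfl, h⟩ := Sigma.mk.inj_iff.1
      (RelCWComplex.eq_of_not_disjoint_openCell (not_disjoint_iff.2 ⟨_, hx, hx'⟩))
    obtain rfl := eq_of_heq h
    rfl
  · replace hp := (wedgeMap_inl_image x₀ y₀ i _).subset hp
    replace hp' := (wedgeMap_inr_image x₀ y₀ j _).subset hp'
    obtain ⟨x, hx, rfl⟩ := hp
    obtain ⟨y, hy, h⟩ := hp'
    -- A point common to the two summands is the base point, and the cells of `Y` containing it were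
    -- removed.
    obtain rfl : y = y₀ := congrArg (Wedge.snd x₀ y₀) h
    exact absurd hy j.2
  · replace hp := (wedgeMap_inr_image x₀ y₀ i _).subset hp
    replace hp' := (wedgeMap_inl_image x₀ y₀ j _).subset hp'
    obtain ⟨y, hy, rfl⟩ := hp
    obtain ⟨x, hx, h⟩ := hp'
    obtain rfl : y₀ = y := congrArg (Wedge.snd x₀ y₀) h
    exact absurd hy i.2
  · replace hp := (wedgeMap_inr_image x₀ y₀ i _).subset hp
    replace hp' := (wedgeMap_inr_image x₀ y₀ j _).subset hp'
    obtain ⟨y, hy, rfl⟩ := hp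
    obtain ⟨y', hy', h⟩ := hp'
    obtain rfl : y' = y := congrArg (Wedge.snd x₀ y₀) h
    obtain ⟨i, hi⟩ := i
    obtain ⟨j, hj⟩ := j
    obtain ⟨rfl, h⟩ := Sigma.mk.inj_iff.1
      (RelCWComplex.eq_of_not_disjoint_openCell (not_disjoint_iff.2 ⟨_, hy, hy'⟩))
    obtain rfl := eq_of_heq h
    rfl

theorem mapsTo_wedgeMap
    (hx : ∃ v : RelCWComplex.cell (univ : Set X) 0,
      x₀ ∈ RelCWComplex.closedCell (C := (univ : Set X)) 0 v)
    (hy : ∃ v : RelCWComplex.cell (univ : Set Y) 0,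
      y₀ ∈ RelCWComplex.closedCell (C := (univ : Set Y)) 0 v) (n : ℕ)
    (i : WedgeCell (X := X) y₀ n) : MapsTo (wedgeMap x₀ y₀ n i) (sphere 0 1)
      (⋃ (m < n) (j : WedgeCell (X := X) y₀ m), wedgeMap x₀ y₀ m j '' closedBall 0 1) := by
  intro t ht
  obtain i | j := i
  · obtain ⟨I, hI⟩ := CWComplex.cellFrontier_subset_finite_closedCell n i
    obtain ⟨m, hm, h⟩ := mem_iUnion₂.1 (hI (mem_image_of_mem _ ht))
    obtain ⟨k, -, hk⟩ := mem_iUnion₂.1 h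
    exact inl_mem_wedgeMap hm hk
  · obtain ⟨I, hI⟩ := CWComplex.cellFrontier_subset_finite_closedCell n j.1
    obtain ⟨m, hm, h⟩ := mem_iUnion₂.1 (hI (mem_image_of_mem _ ht))
    obtain ⟨k, -, hk⟩ := mem_iUnion₂.1 h
    exact inr_mem_wedgeMap hx hy hm hk

theorem iUnion_wedgeMap
    (hx : ∃ v : RelCWComplex.cell (univ : Set X) 0,
      x₀ ∈ RelCWComplex.closedCell (C := (univ : Set X)) 0 v)
    (hy : ∃ v : RelCWComplex.cell (univ : Set Y) 0,
      y₀ ∈ RelCWComplex.closedCell (C := (univ : Set Y)) 0 v) :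
    ⋃ (n : ℕ) (j : WedgeCell (X := X) y₀ n), wedgeMap x₀ y₀ n j '' closedBall 0 1 = univ := by
  refine eq_univ_of_forall fun p => ?_
  have key : ∀ n, (⋃ (m < n) (j : WedgeCell (X := X) y₀ m),
      wedgeMap x₀ y₀ m j '' closedBall 0 1) ⊆
        ⋃ (n : ℕ) (j : WedgeCell (X := X) y₀ n), wedgeMap x₀ y₀ n j '' closedBall 0 1 :=
    fun n => iUnion_mono fun m => iUnion_subset fun _ => Subset.rfl
  obtain h | h := Wedge.inl_fst_or_inr_snd p <;> rw [← h]
  · have : Wedge.fst x₀ y₀ p ∈ (univ : Set X) := mem_univ _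
    rw [← CWComplex.union (C := (univ : Set X))] at this
    obtain ⟨n, j, hj⟩ := mem_iUnion₂.1 this
    exact key _ (inl_mem_wedgeMap n.lt_succ_self hj)
  · have : Wedge.snd x₀ y₀ p ∈ (univ : Set Y) := mem_univ _
    rw [← CWComplex.union (C := (univ : Set Y))] at this
    obtain ⟨n, j, hj⟩ := mem_iUnion₂.1 this
    exact key _ (inr_mem_wedgeMap hx hy n.lt_succ_self hj)

theorem eventually_isEmpty_wedgeCell [RelCWComplex.Finite (univ : Set X)]
    [RelCWComplex.Finite (univ : Set Y)] :
    ∀ᶠ n in Filter.atTop, IsEmpty (WedgeCell (X := X) y₀ n) := by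
  filter_upwards
    [RelCWComplex.FiniteDimensional.eventually_isEmpty_cell (C := (univ : Set X)) (D := ∅),
    RelCWComplex.FiniteDimensional.eventually_isEmpty_cell (C := (univ : Set Y)) (D := ∅)]
    with n h h'
  exact ⟨Sum.rec h.false fun j => h'.false j.1⟩

theorem finite_wedgeCell [RelCWComplex.Finite (univ : Set X)]
    [RelCWComplex.Finite (univ : Set Y)] (n : ℕ) : Finite (WedgeCell (X := X) y₀ n) := by
  have := RelCWComplex.FiniteType.finite_cell (C := (univ : Set X)) (D := ∅) n
  have := RelCWComplex.FiniteType.finite_cell (C := (univ : Set Y)) (D := ∅) n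
  infer_instance

/-- The CW structure on the wedge of two finite CW complexes at vertices. -/
@[reducible]
def wedgeCWComplex [RelCWComplex.Finite (univ : Set X)] [RelCWComplex.Finite (univ : Set Y)]
    (hx : ∃ v : RelCWComplex.cell (univ : Set X) 0,
      x₀ ∈ RelCWComplex.closedCell (C := (univ : Set X)) 0 v)
    (hy : ∃ v : RelCWComplex.cell (univ : Set Y) 0,
      y₀ ∈ RelCWComplex.closedCell (C := (univ : Set Y)) 0 v) :
    CWComplex (univ : Set (Wedge x₀ y₀)) :=
  CWComplex.mkFinite univ (WedgeCell (X := X) y₀) (wedgeMap x₀ y₀) eventually_isEmpty_wedgeCell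
    finite_wedgeCell wedgeMap_source continuousOn_wedgeMap continuousOn_wedgeMap_symm
    pairwiseDisjoint_wedgeMap (mapsTo_wedgeMap hx hy) (iUnion_wedgeMap hx hy)

theorem finite_wedgeCWComplex [RelCWComplex.Finite (univ : Set X)]
    [RelCWComplex.Finite (univ : Set Y)]
    (hx : ∃ v : RelCWComplex.cell (univ : Set X) 0,
      x₀ ∈ RelCWComplex.closedCell (C := (univ : Set X)) 0 v)
    (hy : ∃ v : RelCWComplex.cell (univ : Set Y) 0,
      y₀ ∈ RelCWComplex.closedCell (C := (univ : Set Y)) 0 v) :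
    letI := wedgeCWComplex hx hy
    RelCWComplex.Finite (univ : Set (Wedge x₀ y₀)) :=
  CWComplex.finite_mkFinite univ (WedgeCell (X := X) y₀) (wedgeMap x₀ y₀)
    eventually_isEmpty_wedgeCell finite_wedgeCell wedgeMap_source continuousOn_wedgeMap
    continuousOn_wedgeMap_symm pairwiseDisjoint_wedgeMap (mapsTo_wedgeMap hx hy)
    (iUnion_wedgeMap hx hy)

theorem base_mem_wedge_vertex [RelCWComplex.Finite (univ : Set X)]
    [RelCWComplex.Finite (univ : Set Y)]
    (hx : ∃ v : RelCWComplex.cell (univ : Set X) 0,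
      x₀ ∈ RelCWComplex.closedCell (C := (univ : Set X)) 0 v)
    (hy : ∃ v : RelCWComplex.cell (univ : Set Y) 0,
      y₀ ∈ RelCWComplex.closedCell (C := (univ : Set Y)) 0 v) :
    letI := wedgeCWComplex hx hy
    ∃ v : RelCWComplex.cell (univ : Set (Wedge x₀ y₀)) 0,
      Wedge.base x₀ y₀ ∈ RelCWComplex.closedCell (C := (univ : Set (Wedge x₀ y₀))) 0 v := by
  obtain ⟨v, t, ht, h⟩ := hx
  exact ⟨Sum.inl v, t, ht, congrArg (Wedge.inl x₀ y₀) h⟩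

end CW

/-! ## `K`-theory of the wedge -/

/-- A constant map factors through the one-point space, where reduced classes vanish. -/
theorem K0.map_const_eq_zero {X Y : Type} [TopologicalSpace X] [TopologicalSpace Y] {y₀ : Y}
    {z : K0 Y} (hz : z ∈ reducedK0 Y y₀) : K0.map (ContinuousMap.const X y₀) z = 0 := by
  have h : K0.map (ContinuousMap.const PUnit y₀) z = 0 := hz
  change K0.map ((ContinuousMap.const PUnit y₀).comp (ContinuousMap.const X PUnit.unit)) z = 0
  rw [← K0.map_map, h, map_zero]

theorem K0.map_section_map_retraction {X Y : Type} [TopologicalSpace X] [TopologicalSpace Y]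
    (i : C(X, Y)) (r : C(Y, X)) (h : r.comp i = ContinuousMap.id X) (z : K0 X) :
    K0.map i (K0.map r z) = z := by
  rw [K0.map_map, h, K0.map_id]

section KWedge

open CVectBundle Wedge

variable {X Y : Type} [TopologicalSpace X] [TopologicalSpace Y] {x₀ : X} {y₀ : Y}

/-- The class is `fst^* u + snd^* v`. The cross terms vanish because each summand's retraction is
constant on the other summand. -/
theorem reducedK0.exists_of_wedge (u : reducedK0 X x₀) (v : reducedK0 Y y₀) :
    ∃ z : reducedK0 (Wedge x₀ y₀) (base x₀ y₀),
      reducedK0.map (inl x₀ y₀) rfl z = u ∧ reducedK0.map (inr x₀ y₀) rfl z = v := by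
  let a : reducedK0 (Wedge x₀ y₀) (base x₀ y₀) := reducedK0.map (fst x₀ y₀) rfl u
  let b : reducedK0 (Wedge x₀ y₀) (base x₀ y₀) := reducedK0.map (snd x₀ y₀) rfl v
  refine ⟨a + b, Subtype.ext ?_, Subtype.ext ?_⟩
  · have h : K0.map (inl x₀ y₀) (K0.map (snd x₀ y₀) v.1) = 0 := by
      rw [K0.map_map]
      exact K0.map_const_eq_zero v.2
    change K0.map (inl x₀ y₀) (K0.map (fst x₀ y₀) u.1 + K0.map (snd x₀ y₀) v.1) = u.1
    rw [map_add, h, K0.map_section_map_retraction _ _ rfl, add_zero]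
  · have h : K0.map (inr x₀ y₀) (K0.map (fst x₀ y₀) u.1) = 0 := by
      rw [K0.map_map]
      exact K0.map_const_eq_zero u.2
    change K0.map (inr x₀ y₀) (K0.map (fst x₀ y₀) u.1 + K0.map (snd x₀ y₀) v.1) = v.1
    rw [map_add, h, K0.map_section_map_retraction _ _ rfl, zero_add]

variable [CompactSpace X] [CompactSpace Y] [T2Space X] [T2Space Y]

theorem K0.eq_zero_of_wedge {z : K0 (Wedge x₀ y₀)} (hX : K0.map (inl x₀ y₀) z = 0)
    (hY : K0.map (inr x₀ y₀) z = 0) : z = 0 := by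
  refine K0.eq_zero_of_map_retraction_eq_zero ((inl x₀ y₀).comp (fst x₀ y₀))
    ((inr x₀ y₀).comp (snd x₀ y₀)) (ContinuousMap.const _ (base x₀ y₀)) (fun _ => rfl)
    (fun _ => rfl) inl_fst_or_inr_snd (fun _ => rfl) (fun _ => rfl) (fun _ => eq_base) ?_ ?_
  · rw [← K0.map_map, hX, map_zero]
  · rw [← K0.map_map, hY, map_zero]

/-- The overlap is now `{base} × P`, still a retract of the whole space; `P` will be the circle. -/
theorem K0.eq_zero_of_wedge_prod {P : Type} [TopologicalSpace P] [CompactSpace P] [T2Space P]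
    {z : K0 (Wedge x₀ y₀ × P)}
    (hX : K0.map ((inl x₀ y₀).prodMap (ContinuousMap.id P)) z = 0)
    (hY : K0.map ((inr x₀ y₀).prodMap (ContinuousMap.id P)) z = 0) : z = 0 := by
  refine K0.eq_zero_of_map_retraction_eq_zero
    (((inl x₀ y₀).prodMap (ContinuousMap.id P)).comp
      ((fst x₀ y₀).prodMap (ContinuousMap.id P)))
    (((inr x₀ y₀).prodMap (ContinuousMap.id P)).comp
      ((snd x₀ y₀).prodMap (ContinuousMap.id P)))
    ((ContinuousMap.const _ (base x₀ y₀)).prodMap (ContinuousMap.id P)) (fun _ => rfl)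
    (fun _ => rfl) (fun p => ?_) (fun _ => rfl) (fun _ => rfl) (fun p h h' => ?_) ?_ ?_
  · exact (inl_fst_or_inr_snd p.1).imp (fun h => Prod.ext h rfl) fun h => Prod.ext h rfl
  · exact Prod.ext (eq_base (congrArg Prod.fst h) (congrArg Prod.fst h')) rfl
  · rw [← K0.map_map, hX, map_zero]
  · rw [← K0.map_map, hY, map_zero]

/-- A class trivial over `Wedge × {1}` restricts on each summand to a class in that summand's `K¹`,
which is zero, so the vanishing criterion applies. -/
theorem K1.subsingleton_wedge [Subsingleton (K1 X)] [Subsingleton (K1 Y)] :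
    Subsingleton (K1 (Wedge x₀ y₀)) := by
  have key : ∀ {Z : Type} [TopologicalSpace Z] [Subsingleton (K1 Z)] (i : C(Z, Wedge x₀ y₀))
      (z : K0 (Wedge x₀ y₀ × Circle)), z ∈ K1 (Wedge x₀ y₀) →
      K0.map (i.prodMap (ContinuousMap.id Circle)) z = 0 := by
    intro Z _ _ i z hz
    have hmem : K0.map (i.prodMap (ContinuousMap.id Circle)) z ∈ K1 Z := by
      have h : K0.map ((ContinuousMap.id (Wedge x₀ y₀)).prodMk
        (ContinuousMap.const (Wedge x₀ y₀) (1 : Circle))) z = 0 := hz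
      change K0.map ((ContinuousMap.id Z).prodMk (ContinuousMap.const Z (1 : Circle))) _ = 0
      rw [K0.map_map]
      change K0.map ((((ContinuousMap.id (Wedge x₀ y₀)).prodMk
        (ContinuousMap.const (Wedge x₀ y₀) (1 : Circle)))).comp i) z = 0
      rw [← K0.map_map, h, map_zero]
    exact congrArg Subtype.val (Subsingleton.elim (⟨_, hmem⟩ : K1 Z) 0)
  refine subsingleton_of_forall_eq 0 fun z => Subtype.ext ?_
  exact K0.eq_zero_of_wedge_prod (key (inl x₀ y₀) z z.2) (key (inr x₀ y₀) z z.2)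

theorem reducedK0.eq_zero_of_wedge {z : reducedK0 (Wedge x₀ y₀) (base x₀ y₀)}
    (hX : reducedK0.map (x₀ := x₀) (inl x₀ y₀) rfl z = 0)
    (hY : reducedK0.map (x₀ := y₀) (inr x₀ y₀) rfl z = 0) : z = 0 :=
  Subtype.ext (K0.eq_zero_of_wedge (congrArg Subtype.val hX) (congrArg Subtype.val hY))

variable (x₀ y₀) in
/-- The reduced `K⁰`-group of a wedge is the product of the reduced `K⁰`-groups. -/
def reducedK0WedgeEquiv :
    reducedK0 (Wedge x₀ y₀) (base x₀ y₀) ≃+ reducedK0 X x₀ × reducedK0 Y y₀ :=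
  AddEquiv.ofBijective ((reducedK0.map (inl x₀ y₀) rfl).prod (reducedK0.map (inr x₀ y₀) rfl))
    ⟨(injective_iff_map_eq_zero _).2 fun _ hz =>
      reducedK0.eq_zero_of_wedge (congrArg Prod.fst hz) (congrArg Prod.snd hz),
    fun w => (reducedK0.exists_of_wedge w.1 w.2).imp fun _ h => Prod.ext h.1 h.2⟩

end KWedge

/-! ## Self-maps of finite order -/

theorem iterate_eq_id_of_dvd {A : Type*} {f : A → A} {m n : ℕ} (h : f^[m] = id) (hmn : m ∣ n) :
    f^[n] = id := by
  obtain ⟨k, rfl⟩ := hmn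
  rw [Function.iterate_mul, h, Function.iterate_id]

/-- The wedge of two pointed self-homeomorphisms. -/
def Wedge.homeomorph {X Y : Type} [TopologicalSpace X] [TopologicalSpace Y] {x₀ : X} {y₀ : Y}
    (β : X ≃ₜ X) (γ : Y ≃ₜ Y) (hβ : β x₀ = x₀) (hγ : γ y₀ = y₀) : Wedge x₀ y₀ ≃ₜ Wedge x₀ y₀ :=
  (β.prodCongr γ).subtype fun p => by
    change _ ↔ β p.1 = x₀ ∨ γ p.2 = y₀
    rw [β.injective.eq_iff' hβ, γ.injective.eq_iff' hγ]

theorem Wedge.hasFiniteOrder_homeomorph {X Y : Type} [TopologicalSpace X] [TopologicalSpace Y]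
    {x₀ : X} {y₀ : Y} {β : X ≃ₜ X} {γ : Y ≃ₜ Y} (hβ : β x₀ = x₀) (hγ : γ y₀ = y₀)
    (h : HasFiniteOrder β) (h' : HasFiniteOrder γ) :
    HasFiniteOrder (Wedge.homeomorph β γ hβ hγ) := by
  obtain ⟨m, hm, h⟩ := h
  obtain ⟨n, hn, h'⟩ := h'
  refine ⟨m * n, Nat.mul_pos hm hn, funext fun p => Subtype.ext ?_⟩
  have key : ∀ k, ((Wedge.homeomorph β γ hβ hγ)^[k] p).1 = (β^[k] p.1.1, γ^[k] p.1.2) := by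
    intro k
    induction k with
    | zero => rfl
    | succ k ih =>
      rw [Function.iterate_succ_apply', Function.iterate_succ_apply',
        Function.iterate_succ_apply']
      change (β ((Wedge.homeomorph β γ hβ hγ)^[k] p).1.1,
        γ ((Wedge.homeomorph β γ hβ hγ)^[k] p).1.2) = _
      rw [ih]
  rw [key, iterate_eq_id_of_dvd h (dvd_mul_right m n), iterate_eq_id_of_dvd h' (dvd_mul_left n m)]
  rfl

/-! ## Realizations -/

theorem RealizationPositive.congr {G H : Type*} [AddCommGroup G] [AddCommGroup H] {σ : G ≃+ G}
    {τ : H ≃+ H} (e : G ≃+ H) (he : ∀ g, e (σ g) = τ (e g)) (h : RealizationPositive G σ) :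
    RealizationPositive H τ := by
  obtain ⟨R⟩ := h
  exact ⟨{ R with
    iso := R.iso.trans e
    iso_equivariant := fun a => (congrArg e (R.iso_equivariant a)).trans (he _) }⟩

theorem RealizationPositive.prod {G H : Type*} [AddCommGroup G] [AddCommGroup H] {σ : G ≃+ G}
    {τ : H ≃+ H} (hG : RealizationPositive G σ) (hH : RealizationPositive H τ) :
    RealizationPositive (G × H) (σ.prodCongr τ) := by
  obtain ⟨R⟩ := hG
  obtain ⟨S⟩ := hH
  let := R.top
  let := S.top
  have := R.t2
  have := S.t2
  have := R.connected
  have := S.connected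
  let := R.cw
  let := S.cw
  have := R.finite
  have := S.finite
  have := compactSpace_of_finite_cwComplex R.W
  have := compactSpace_of_finite_cwComplex S.W
  have := R.K1_trivial
  have := S.K1_trivial
  let cw := wedgeCWComplex R.base_vertex S.base_vertex
  exact ⟨{
    W := Wedge R.base S.base
    cw := cw
    finite := finite_wedgeCWComplex R.base_vertex S.base_vertex
    base := Wedge.base R.base S.base
    base_vertex := base_mem_wedge_vertex R.base_vertex S.base_vertex
    β := Wedge.homeomorph R.β S.β R.β_base S.β_base
    β_base := Subtype.ext (Prod.ext R.β_base S.β_base)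
    β_finite := Wedge.hasFiniteOrder_homeomorph R.β_base S.β_base R.β_finite S.β_finite
    iso := (reducedK0WedgeEquiv R.base S.base).trans (R.iso.prodCongr S.iso)
    iso_equivariant := fun a => by
      -- Equivariance is checked on each factor; it holds because the wedge homeomorphism commutes
      -- with the two inclusions.
      have hl : (Wedge.homeomorph R.β S.β R.β_base S.β_base : C(_, _)).comp
          (Wedge.inl R.base S.base) = (Wedge.inl R.base S.base).comp (R.β : C(R.W, R.W)) :=
        ContinuousMap.ext fun x => Subtype.ext (Prod.ext rfl S.β_base)
      have hr : (Wedge.homeomorph R.β S.β R.β_base S.β_base : C(_, _)).comp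
          (Wedge.inr R.base S.base) = (Wedge.inr R.base S.base).comp (S.β : C(S.W, S.W)) :=
        ContinuousMap.ext fun x => Subtype.ext (Prod.ext R.β_base rfl)
      refine Prod.ext ?_ ?_
      · refine Eq.trans (congrArg R.iso (Subtype.ext ?_))
          (R.iso_equivariant (reducedK0.map (Wedge.inl R.base S.base) rfl a))
        change K0.map _ (K0.map _ a.1) = K0.map _ (K0.map _ a.1)
        rw [K0.map_map, K0.map_map, hl]
      · refine Eq.trans (congrArg S.iso (Subtype.ext ?_))
          (S.iso_equivariant (reducedK0.map (Wedge.inr R.base S.base) rfl a))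
        change K0.map _ (K0.map _ a.1) = K0.map _ (K0.map _ a.1)
        rw [K0.map_map, K0.map_map, hr]
    K1_trivial := K1.subsingleton_wedge }⟩

/-- Splitting off the first factor of a finite product. -/
def addEquivFinSucc {k : ℕ} (G : Fin (k + 1) → Type*) [∀ i, AddCommGroup (G i)] :
    G 0 × (∀ i : Fin k, G i.succ) ≃+ ∀ i, G i where
  toFun p := Fin.cons p.1 p.2
  invFun f := (f 0, fun i => f i.succ)
  left_inv _ := rfl
  right_inv f := Fin.cons_self_tail f
  map_add' p q := by
    funext i
    refine Fin.cases ?_ (fun i => ?_) i <;> simp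

/-- The induction starts at one factor, so only binary wedges of realizations are ever formed. -/
theorem RealizationPositive.pi : ∀ {k : ℕ}, 1 ≤ k → ∀ (G : Fin k → Type*)
    [∀ i, AddCommGroup (G i)] (σ : ∀ i, G i ≃+ G i), (∀ i, RealizationPositive (G i) (σ i)) →
    RealizationPositive (∀ i, G i) (AddEquiv.piCongrRight σ)
  | 1, _, G, _, σ, h => (h 0).congr (AddEquiv.piUnique G).symm fun g => by
      funext i
      obtain rfl := Subsingleton.elim i 0
      rfl
  | k + 2, _, G, _, σ, h => by
      refine ((h 0).prod (RealizationPositive.pi (Nat.succ_pos k) (fun i => G i.succ)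
        (fun i => σ i.succ) fun i => h i.succ)).congr (addEquivFinSucc G) fun g => ?_
      funext i
      refine Fin.cases ?_ (fun i => ?_) i <;> rfl

theorem hasFiniteOrder_directSumAut {k : ℕ} {G : Fin k → Type*} [∀ i, AddCommGroup (G i)]
    {σ : ∀ i, G i ≃+ G i} (h : ∀ i, HasFiniteOrder (σ i)) : HasFiniteOrder (directSumAut σ) := by
  choose n hn h using h
  refine ⟨∏ i, n i, Finset.prod_pos fun i _ => hn i, funext fun x => DFinsupp.ext fun i => ?_⟩
  have key : ∀ m, ((directSumAut σ)^[m] x) i = (σ i)^[m] (x i) := by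
    intro m
    induction m with
    | zero => rfl
    | succ m ih =>
      rw [Function.iterate_succ_apply', Function.iterate_succ_apply', ← ih]
      rfl
  rw [key, iterate_eq_id_of_dvd (h i) (Finset.dvd_prod_of_mem n (Finset.mem_univ i))]
  rfl

theorem fg_directSum {k : ℕ} {G : Fin k → Type*} [∀ i, AddCommGroup (G i)]
    (h : ∀ i, AddGroup.FG (G i)) : AddGroup.FG (⨁ i, G i) := by
  have := fun i => Module.Finite.iff_addGroup_fg.2 (h i)
  exact Module.Finite.iff_addGroup_fg.1 inferInstance

theorem RealizationPositive.directSum {k : ℕ} (hk : 1 ≤ k) (G : Fin k → Type*)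
    [∀ i, AddCommGroup (G i)] (σ : ∀ i, G i ≃+ G i) (h : ∀ i, RealizationPositive (G i) (σ i)) :
    RealizationPositive (⨁ i, G i) (directSumAut σ) :=
  (RealizationPositive.pi hk G σ h).congr (DirectSum.addEquivProd G).symm fun g => by
    refine (DirectSum.addEquivProd G).injective ?_
    rw [AddEquiv.apply_symm_apply]
    funext i
    change σ i (g i) = σ i ((DirectSum.addEquivProd G) ((DirectSum.addEquivProd G).symm g) i)
    rw [AddEquiv.apply_symm_apply]

end TopKTheory

end

theorem mainTheorem10 {k : ℕ} (hk : 1 ≤ k) (G : Fin k → Type*) [∀ i, AddCommGroup (G i)]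
    (σ : ∀ i, G i ≃+ G i) (hG : ∀ i, AddGroup.FG (G i)) (hσ : ∀ i, TopKTheory.HasFiniteOrder (σ i))
    (h : ∀ i, TopKTheory.RealizationPositive (G i) (σ i)) :
    AddGroup.FG (⨁ i, G i) ∧ TopKTheory.HasFiniteOrder (TopKTheory.directSumAut σ) ∧
      TopKTheory.RealizationPositive (⨁ i, G i) (TopKTheory.directSumAut σ) :=
  ⟨TopKTheory.fg_directSum hG, TopKTheory.hasFiniteOrder_directSumAut hσ,
    TopKTheory.RealizationPositive.directSum hk G σ h⟩
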